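/- **Setting.** Let $B$ be a $d$-dimensional Brownian motion on a probability space, $T>0$, and let $X$ be the strong solution of $dX_t=b(X_t)\,dt+a(X_t)\,dB_t$, $X_0=x_0\in\mathbb R^d$, where $b:\mathbb R^d\to\mathbb R^d$ and $a:\mathbb R^d\to\mathbb R^{d\times d}$ are bounded and uniformly Lipschitz, $a(x)$ is invertible for each $x$, and $a^{-1}$ is bounded. For $t\le T$ and $x\in\mathbb R^d$, $E[\varphi(X_T)\mid X_t=x]$ denotes $E[\varphi(X^{t,x}_T)]$, where $X^{t,x}$ is the strong solution started from $x$ at time $t$. Let $\Pi,\pi^U_0,\mu_N\in\mathbb R^d$, let $\tau_N\in\mathbb R$, let $C_I,C_N$ be symmetric positive definite $d\times d$ matrices, let $\gamma_I,\gamma_N>0$, let $\omega_I,\omega_N>0$ with $\omega_U:=1-\omega_I-\omega_N>0$, and set $$\alpha_j:=\omega_j/\gamma_j\ (j=I,N),\qquad P_I:=C_I^{-1},\qquad P_U:=\Big(C_I+\Big(\tfrac{\alpha_N}{\alpha_I+\alpha_N\tau_N}\Big)^2C_N\Big)^{-1},$$ where $\alpha_I+\alpha_N\tau_N\ne0$.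 The payoff $\Psi:\mathbb R^d\to\mathbb R^d$ is $C^1$ with $\Pi'\Psi(x)>0$ for all $x$, its Jacobian has full rank for Lebesgue-a.e. $x$, and for some $K>0$ both $|\Psi(x)|$ and $|\partial_{x_i}\Psi(x)|$, $i=1,\dots,d$, are at most $e^{K(1+|x|)}$ for all $x$. Moreover $(\pi_0^U)'\Psi(X_T)>0$ almost surely. Put $$\vartheta(x,h):=\Pi'\Psi(x)-\alpha_Nx'P_I\mu_N+\tfrac12(\alpha_I+\alpha_N)x'(P_I-P_U)x-x'\big((\alpha_I+\alpha_N\tau_N)P_I-(\alpha_I+\alpha_N)P_U\big)h,$$ $$\chi(x,h):=\Pi'\Psi(x)+\tfrac12(\alpha_I+\alpha_N)x'P_Ix-\big((\alpha_I+\alpha_N\tau_N)h+\alpha_N\mu_N\big)'P_Ix .$$ **The equilibrium price.** Let the uninformed agent have CRRA utility $U$ with relative risk aversion $\eta>0$, that is $U(w)=w^{1-\eta}/(1-\eta)$ if $\eta\neq 1$ and $U(w)=\log w$ if $\eta=1$, and let $I=\dot U^{-1}$, so that $I(z)=z^{-1/\eta}$. Let $z=z(x,h,\kappa;\eta)>0$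 be the unique solution of $$\omega_UI(z)-(\alpha_I+\alpha_N)\log z=\vartheta(x,h)+\kappa .$$ Let $\widehat\kappa=\widehat\kappa(h;\eta)$ be any number that enforces the budget constraint $$E\Big[\big((\pi_0^U)'\Psi(X_T)-I(z(X_T,h,\widehat\kappa;\eta))\big)\,z(X_T,h,\widehat\kappa;\eta)\,e^{-\frac12X_T'P_UX_T+X_T'P_Uh}\Big]=0 ,$$ and let $\lambda(h):=E\big[z(X_T,h,\widehat\kappa;\eta)e^{-\frac12X_T'P_UX_T+X_T'P_Uh}\big]$ and $\check Z(x,h):=\lambda(h)^{-1}z(x,h,\widehat\kappa;\eta)e^{-\frac12x'P_Ux+x'P_Uh}$. With $d\mathbb Q^h/d\mathbb P:=\check Z(X_T,h)$, the equilibrium pricing function is $$S(t,x,h;\eta):=E^{\mathbb Q^h}[\Psi(X_T)\mid X_t=x]=\frac{E[\Psi(X_T)\check Z(X_T,h)\mid X_t=x]}{E[\check Z(X_T,h)\mid X_t=x]} .$$ **Proposition 8.1.** For all $\eta>0$ and $h\in\mathbb R^d$ such a $\widehat\kappa(h;\eta)$ exists. For each such $\widehat\kappa$ all expectations below and above are finite,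 $E[\check Z(X_T,h)]=1$, and the market clears: writing $w^U_0:=(\pi_0^U)'E^{\mathbb Q^h}[\Psi(X_T)]$ and $\widehat{\mathcal W}(x):=I\big(\lambda(h)\check Z(x,h)e^{\frac12x'P_Ux-x'P_Uh}\big)$, one has $E^{\mathbb Q^h}[\widehat{\mathcal W}(X_T)]=w^U_0$ and, for all $x$, $$\chi(x,h)-E^{\mathbb Q^h}[\chi(X_T,h)]=\omega_U\big(\widehat{\mathcal W}(x)-w_0^U\big)-(\alpha_I+\alpha_N)\big(\log\check Z(x,h)-E^{\mathbb Q^h}[\log\check Z(X_T,h)]\big).$$ For every choice of the $\widehat\kappa(h;\eta)$ and all $t\in[0,T]$, $x,h\in\mathbb R^d$, $$\lim_{\eta\to\infty}S(t,x,h;\eta)=S(t,x,h;\infty):=\frac{E\Big[\Psi(X_T)e^{-\frac{\vartheta(X_T,h)}{\alpha_I+\alpha_N}-\frac12X_T'P_UX_T+X_T'P_Uh}\,\Big|\,X_t=x\Big]}{E\Big[e^{-\frac{\vartheta(X_T,h)}{\alpha_I+\alpha_N}-\frac12X_T'P_UX_T+X_T'P_Uh}\,\Big|\,X_t=x\Big]}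 .$$ This limit is the price in the economy with only the two CARA agents: for each $h$ there is a positive function $\check Z$ with $E[\check Z(X_T)]=1$ that satisfies, with all expectations finite, the clearing condition without the term of the uninformed agent, $$\chi(x,h)-E[\check Z(X_T)\chi(X_T,h)]=-(\alpha_I+\alpha_N)\big(\log\check Z(x)-E[\check Z(X_T)\log\check Z(X_T)]\big)\quad\text{for all }x,$$ and for each such $\check Z$ one has $E[\Psi(X_T)\check Z(X_T)\mid X_t=x]/E[\check Z(X_T)\mid X_t=x]=S(t,x,h;\infty)$ for all $t\in[0,T]$ and $x\in\mathbb R^d$. -/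

import Mathlib

open MeasureTheory ProbabilityTheory Filter Topology Set
open scoped NNReal Matrix

noncomputable section

namespace MixedEconomy

/-- Column vectors of length `d`, with the Euclidean norm. -/
abbrev Vec (d : ℕ) : Type := EuclideanSpace ℝ (Fin d)

variable {d : ℕ} {Ω : Type*}

/-- The product of a matrix and a column vector. -/
def matVec (M : Matrix (Fin d) (Fin d) ℝ) (v : Vec d) : Vec d :=
  WithLp.toLp 2 (M *ᵥ v.ofLp)

/-- The bilinear form `x' M y`. -/
def bil (M : Matrix (Fin d) (Fin d) ℝ) (x y : Vec d) : ℝ := inner ℝ x (matVec M y)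

/-! ### The factor process -/

/-- `B` is a standard `d`-dimensional Brownian motion: its coordinates are independent standard
real Brownian motions. -/
structure IsBrownianVec [MeasurableSpace Ω] (P : Measure Ω) (B : ℝ≥0 → Ω → Vec d) : Prop where
  measurable : ∀ t, Measurable (B t)
  brownian : ∀ i, IsBrownianReal (fun t ω => B t ω i) P
  indep : iIndepFun (fun (i : Fin d) (ω : Ω) (t : ℝ≥0) => B t ω i) P

/-- The sigma-algebra generated by `B r`, `r ≤ t`. A map is measurable for its augmentation by
the `P`-null sets exactly when it is `P`-a.e. equal to a map that is measurable for it. -/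
abbrev pastOf (B : ℝ≥0 → Ω → Vec d) (t : ℝ≥0) : MeasurableSpace Ω :=
  ⨆ r ≤ t, MeasurableSpace.comap (B r) inferInstance

/-- The `k`-th point of the partition of `[s, t]` into `n + 1` intervals of equal length. -/
def gridPoint (s t : ℝ≥0) (n k : ℕ) : ℝ≥0 := s + (k : ℝ≥0) / ((n : ℝ≥0) + 1) * (t - s)

/-- The left-endpoint Riemann sum of `∫_s^t Σ_u dB_u` along the partition of `[s, t]` into `n + 1`
intervals of equal length. For a continuous adapted matrix-valued integrand `Σ` these sums
converge in probability, and the limit is the Itô integral. -/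
def itoSum (B : ℝ≥0 → Ω → Vec d) (Sig : ℝ≥0 → Ω → Matrix (Fin d) (Fin d) ℝ) (s t : ℝ≥0)
    (n : ℕ) (ω : Ω) : Vec d :=
  ∑ k ∈ Finset.range (n + 1),
    matVec (Sig (gridPoint s t n k) ω) (B (gridPoint s t n (k + 1)) ω - B (gridPoint s t n k) ω)

/-- The process `X` is a strong solution on `[s, T]` of the stochastic differential equation
`dX = b(X) dt + a(X) dB`, `X_s = x`: it is adapted to the augmented filtration of `B`, has
continuous paths, and `X_t - x - ∫_s^t b(X_u) du` is the Itô integral `∫_s^t a(X_u) dB_u`. -/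
structure IsStrongSolution [MeasurableSpace Ω] (P : Measure Ω) (B : ℝ≥0 → Ω → Vec d)
    (b : Vec d → Vec d) (a : Vec d → Matrix (Fin d) (Fin d) ℝ) (T s : ℝ≥0) (x : Vec d)
    (X : ℝ≥0 → Ω → Vec d) : Prop where
  adapted : ∀ t, s ≤ t → t ≤ T → AEStronglyMeasurable[pastOf B t] (X t) P
  continuous_paths : ∀ᵐ ω ∂P, ContinuousOn (fun t => X t ω) (Icc s T)
  initial : ∀ᵐ ω ∂P, X s ω = x
  equation : ∀ t, s ≤ t → t ≤ T →
    TendstoInMeasure P (fun n => itoSum B (fun u ω => a (X u ω)) s t n) atTop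
      (fun ω => X t ω - x - ∫ u in (s : ℝ)..(t : ℝ), b (X u.toNNReal ω))

/-- The assumption on the drift `b` and the volatility `a`. Boundedness and Lipschitz continuity
of matrix-valued maps are expressed through the entries. -/
structure IsRegularDiffusion (b : Vec d → Vec d) (a : Vec d → Matrix (Fin d) (Fin d) ℝ) :
    Prop where
  drift_bounded : ∃ K : ℝ, ∀ x, ‖b x‖ ≤ K
  drift_lipschitz : ∃ K : ℝ≥0, LipschitzWith K b
  vol_bounded : ∃ K : ℝ, ∀ x i j, |a x i j| ≤ K
  vol_lipschitz : ∃ K : ℝ≥0, ∀ i j, LipschitzWith K (fun x => a x i j)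
  vol_invertible : ∀ x, IsUnit (a x)
  vol_inv_bounded : ∃ K : ℝ, ∀ x i j, |(a x)⁻¹ i j| ≤ K

/-! ### The economy -/

/-- The data of the economy, apart from the factor process and the utility function of the
uninformed agent. -/
structure Economy (d : ℕ) where
  /-- the payoff function `Ψ` -/
  payoff : Vec d → Vec d
  /-- the outstanding supply `Π` -/
  supply : Vec d
  /-- the initial share position of the uninformed agent -/
  shareU : Vec d
  /-- the weight of the insider -/
  omegaI : ℝ
  /-- the weight of the noise trader -/
  omegaN : ℝ
  /-- the absolute risk aversion of the insider -/
  gammaI : ℝ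
  /-- the absolute risk aversion of the noise trader -/
  gammaN : ℝ
  /-- the loading of the noise trader signal on the insider signal -/
  tauN : ℝ
  /-- the shift in the noise trader signal -/
  muN : Vec d
  /-- the covariance matrix of the noise in the insider signal -/
  covI : Matrix (Fin d) (Fin d) ℝ
  /-- the covariance matrix of the extra noise in the noise trader signal -/
  covN : Matrix (Fin d) (Fin d) ℝ

namespace Economy

variable (e : Economy d)

/-- The weight of the uninformed agent. -/
def omegaU : ℝ := 1 - e.omegaI - e.omegaN

/-- The weighted risk tolerance of the insider. -/
def alphaI : ℝ := e.omegaI / e.gammaI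

/-- The weighted risk tolerance of the noise trader. -/
def alphaN : ℝ := e.omegaN / e.gammaN

/-- The precision of the insider signal. -/
def precI : Matrix (Fin d) (Fin d) ℝ := e.covI⁻¹

/-- The covariance matrix of the noise in the market signal
`H = X_T + Y_I + α_N / (α_I + α_N τ_N) Y_N`. -/
def covU : Matrix (Fin d) (Fin d) ℝ :=
  e.covI + (e.alphaN / (e.alphaI + e.alphaN * e.tauN)) ^ 2 • e.covN

/-- The precision of the market signal. -/
def precU : Matrix (Fin d) (Fin d) ℝ := e.covU⁻¹

/-- The standing conditions on the parameters; `signal_ne_zero` says that the market signal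
`(α_I G_I + α_N (G_N - μ_N)) / (α_I + α_N τ_N)` is defined. -/
structure ValidParameters : Prop where
  omegaI_pos : 0 < e.omegaI
  omegaN_pos : 0 < e.omegaN
  omegaU_pos : 0 < e.omegaU
  gammaI_pos : 0 < e.gammaI
  gammaN_pos : 0 < e.gammaN
  covI_posDef : e.covI.PosDef
  covN_posDef : e.covN.PosDef
  signal_ne_zero : e.alphaI + e.alphaN * e.tauN ≠ 0

/-- The assumption on the payoff function. -/
structure ValidPayoff : Prop where
  contDiff : ContDiff ℝ 1 e.payoff
  supply_payoff_pos : ∀ x, 0 < inner ℝ e.supply (e.payoff x)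
  jacobian_full_rank : ∀ᵐ x : Vec d, (fderiv ℝ e.payoff x).det ≠ 0
  growth : ∃ K : ℝ, 0 < K ∧ ∀ x, ‖e.payoff x‖ ≤ Real.exp (K * (1 + ‖x‖)) ∧
    ∀ i, ‖fderiv ℝ e.payoff x (EuclideanSpace.single i 1)‖ ≤ Real.exp (K * (1 + ‖x‖))

/-- The function `χ(x, h)`, which collects the aggregate payoff and the informed demand terms in
the clearing condition. -/
def chi (x h : Vec d) : ℝ :=
  inner ℝ e.supply (e.payoff x) + (e.alphaI + e.alphaN) * (1 / 2) * bil e.precI x x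
    - bil e.precI ((e.alphaI + e.alphaN * e.tauN) • h + e.alphaN • e.muN) x

/-- The function `ϑ(x, h)`. -/
def vartheta (x h : Vec d) : ℝ :=
  inner ℝ e.supply (e.payoff x) - e.alphaN * bil e.precI x e.muN
    + 1 / 2 * (e.alphaI + e.alphaN) * bil (e.precI - e.precU) x x
    - bil ((e.alphaI + e.alphaN * e.tauN) • e.precI - (e.alphaI + e.alphaN) • e.precU) x h

/-- The factor `exp(- x' P_U x / 2 + x' P_U h)`, proportional to the likelihood of the market
signal `h` when the terminal factor is `x`. -/
def signalWeight (x h : Vec d) : ℝ :=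
  Real.exp (-(1 / 2) * bil e.precU x x + bil e.precU x h)

end Economy

/-! ### The uninformed agent -/

/-- The CRRA utility function with relative risk aversion `η`. -/
def crra (η : ℝ) (w : ℝ) : ℝ := if η = 1 then Real.log w else w ^ (1 - η) / (1 - η)

/-- The inverse of the marginal utility of a utility function on `(0, ∞)`. -/
def invMarginal (U : ℝ → ℝ) : ℝ → ℝ := Function.invFunOn (deriv U) (Ioi 0)

/-! ### Prices and equilibrium at a given realization of the market signal

Below, `Y` stands for a random vector that is distributed as the terminal factor `X_T`, started
from a given point at a given time. -/

namespace Economy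

variable (e : Economy d)

/-- For the law of `X_T` given `X_t = x`, carried by `Y` under `P`, and a density `Z` with respect
to it that need not be normalized: the price `E[Z(Y) Ψ(Y)] / E[Z(Y)]`. -/
def price [MeasurableSpace Ω] (P : Measure Ω) (Y : Ω → Vec d) (Z : Vec d → ℝ) : Vec d :=
  (∫ ω, Z (Y ω) ∂P)⁻¹ • ∫ ω, Z (Y ω) • e.payoff (Y ω) ∂P

/-- The expectations in `price` are finite and the denominator is positive. -/
def PriceDefined [MeasurableSpace Ω] (P : Measure Ω) (Y : Ω → Vec d) (Z : Vec d → ℝ) : Prop :=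
  Integrable (fun ω => Z (Y ω)) P ∧ 0 < ∫ ω, Z (Y ω) ∂P ∧
    Integrable (fun ω => Z (Y ω) • e.payoff (Y ω)) P

/-- The unique `z > 0` with `ω_U I(z) - (α_I + α_N) log z = ϑ(x, h) + κ`, where `I` is the inverse
marginal utility of `U`. -/
def clearingZ (U : ℝ → ℝ) (x h : Vec d) (κ : ℝ) : ℝ :=
  Classical.epsilon fun z : ℝ => 0 < z ∧
    e.omegaU * invMarginal U z - (e.alphaI + e.alphaN) * Real.log z = e.vartheta x h + κ

/-- The constant `κ` enforces the budget constraint of the uninformed agent at the signal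
realization `h`; the numerator of the constraint is set to zero. -/
def BudgetHolds [MeasurableSpace Ω] (P : Measure Ω) (XT : Ω → Vec d) (U : ℝ → ℝ) (h : Vec d)
    (κ : ℝ) : Prop :=
  ∫ ω, (inner ℝ e.shareU (e.payoff (XT ω)) - invMarginal U (e.clearingZ U (XT ω) h κ))
    * e.clearingZ U (XT ω) h κ * e.signalWeight (XT ω) h ∂P = 0

/-- The multiplier `λ(h, κ)` of the uninformed agent. -/
def multiplier [MeasurableSpace Ω] (P : Measure Ω) (XT : Ω → Vec d) (U : ℝ → ℝ) (h : Vec d)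
    (κ : ℝ) : ℝ :=
  ∫ ω, e.clearingZ U (XT ω) h κ * e.signalWeight (XT ω) h ∂P

/-- The density `Ž(x, h, κ)` of the pricing measure `Q^h`, as a function of the terminal
factor. -/
def pricingDensity [MeasurableSpace Ω] (P : Measure Ω) (XT : Ω → Vec d) (U : ℝ → ℝ) (h : Vec d)
    (κ : ℝ) (x : Vec d) : ℝ :=
  e.clearingZ U x h κ * e.signalWeight x h / e.multiplier P XT U h κ

/-- The terminal wealth that is optimal for the uninformed agent at the signal realization `h`,
given the multiplier `lam` and the density `Z` of the pricing measure. -/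
def wealthU (U : ℝ → ℝ) (h : Vec d) (lam : ℝ) (Z : Vec d → ℝ) (x : Vec d) : ℝ :=
  invMarginal U (lam * Z x * Real.exp (1 / 2 * bil e.precU x x - bil e.precU x h))

/-- The density `Z` of the pricing measure `Q^h` and the multiplier `lam` satisfy the market
clearing condition of the three-agent economy and the budget constraint of the uninformed agent,
at the signal realization `h`, and all the expectations involved are finite. -/
structure Clears [MeasurableSpace Ω] (P : Measure Ω) (XT : Ω → Vec d) (U : ℝ → ℝ) (h : Vec d)
    (lam : ℝ) (Z : Vec d → ℝ) : Prop where
  lam_pos : 0 < lam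
  pos : ∀ x, 0 < Z x
  integrable : Integrable (fun ω => Z (XT ω)) P
  expect_one : ∫ ω, Z (XT ω) ∂P = 1
  integrable_payoff : Integrable (fun ω => Z (XT ω) • e.payoff (XT ω)) P
  integrable_chi : Integrable (fun ω => Z (XT ω) * e.chi (XT ω) h) P
  integrable_log : Integrable (fun ω => Z (XT ω) * Real.log (Z (XT ω))) P
  integrable_wealth : Integrable (fun ω => Z (XT ω) * e.wealthU U h lam Z (XT ω)) P
  budget : ∫ ω, Z (XT ω) * e.wealthU U h lam Z (XT ω) ∂P
    = inner ℝ e.shareU (∫ ω, Z (XT ω) • e.payoff (XT ω) ∂P)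
  clearing : ∀ x, e.chi x h - ∫ ω, Z (XT ω) * e.chi (XT ω) h ∂P
    = e.omegaU * (e.wealthU U h lam Z x
        - inner ℝ e.shareU (∫ ω, Z (XT ω) • e.payoff (XT ω) ∂P))
      - (e.alphaI + e.alphaN)
        * (Real.log (Z x) - ∫ ω, Z (XT ω) * Real.log (Z (XT ω)) ∂P)

/-- The same condition for the economy in which only the insider and the noise trader, the two
CARA agents, are present. -/
structure ClearsCARA [MeasurableSpace Ω] (P : Measure Ω) (XT : Ω → Vec d) (h : Vec d)
    (Z : Vec d → ℝ) : Prop where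
  pos : ∀ x, 0 < Z x
  integrable : Integrable (fun ω => Z (XT ω)) P
  expect_one : ∫ ω, Z (XT ω) ∂P = 1
  integrable_payoff : Integrable (fun ω => Z (XT ω) • e.payoff (XT ω)) P
  integrable_chi : Integrable (fun ω => Z (XT ω) * e.chi (XT ω) h) P
  integrable_log : Integrable (fun ω => Z (XT ω) * Real.log (Z (XT ω))) P
  clearing : ∀ x, e.chi x h - ∫ ω, Z (XT ω) * e.chi (XT ω) h ∂P
    = -(e.alphaI + e.alphaN)
      * (Real.log (Z x) - ∫ ω, Z (XT ω) * Real.log (Z (XT ω)) ∂P)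

/-- The weight `exp(- ϑ(x, h) / (α_I + α_N) - x' P_U x / 2 + x' P_U h)`. -/
def limitWeight (h x : Vec d) : ℝ :=
  Real.exp (-e.vartheta x h / (e.alphaI + e.alphaN)
    - 1 / 2 * bil e.precU x x + bil e.precU x h)

end Economy

end MixedEconomy

end

namespace MixedEconomy

variable {d : ℕ} {Ω : Type*}

/-! ### The bilinear form -/

/-! Write `α = α_I + α_N`, `w = ω_U` and `l = log z`. For CRRA utility the clearing equation reads
`w exp(-l/η) - α l = ϑ + κ`. Its left side decreases in `l` with slope at most `-α`, so `l` is a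
`1/α`-Lipschitz function of `ϑ + κ`. Let `l₀` be the solution at `ϑ = 0`, `D = l - l₀`, and let `W =
exp(-l₀/η)` be the reference wealth of the uninformed agent. Subtracting the two equations gives `α
D + ϑ = w W (exp(-D/η) - 1)` (`logClearing_sub_eq`), and everything rests on this identity. The
factor `exp l₀` cancels in every normalized quantity.

Domination: the identity yields `exp D ≤ 1 + exp(-ϑ/α)`, so all pricing densities, up to constants,
lie below `envelope`, which depends on neither `η` nor `κ`. Both terms of `envelope` have Gaussian
decay: the signal weight because `P_U` is positive definite, the limit weight because it equals
`exp(-χ/α)`, where `P_I` is positive definite and `Π'Ψ > 0`. Gaussian decay makes the products with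
functions of exponential growth bounded, so no moment estimate for `X_T` is needed.

Convergence: since `|D| ≤ |ϑ|/α`, the identity shows `D → -ϑ/α` as soon as `W (exp(s/η) - 1) → 0`
for every `s`; this holds if `W` stays bounded as `η → ∞`. The budget constraint provides the bound:
wealth times density is `W exp((1 - 1/η) D)` times the signal weight, and `|1 - 1/η| ≤ 1` for `η ≥
1`, so that `W` is at most a constant free of `η` (`wealth_bound_of_budgetGap_nonneg`,
`tendsto_wealth_effect`).

Existence of `κ` is the intermediate value theorem: the gap between endowment and wealth is
nonpositive for large `W` and positive for small `W`. Without the uninformed agent, clearing forces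
the density to be proportional to `exp(-χ/α)`, which is the limit weight. -/

theorem matVec_eq_clm (M : Matrix (Fin d) (Fin d) ℝ) (v : Vec d) :
    matVec M v = Matrix.toEuclideanCLM (𝕜 := ℝ) M v := rfl

theorem continuous_matVec (M : Matrix (Fin d) (Fin d) ℝ) : Continuous (matVec M) :=
  (Matrix.toEuclideanCLM (𝕜 := ℝ) M).continuous

theorem continuous_bil (M : Matrix (Fin d) (Fin d) ℝ) {Y : Type*} [TopologicalSpace Y]
    {f g : Y → Vec d} (hf : Continuous f) (hg : Continuous g) :
    Continuous fun y => bil M (f y) (g y) :=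
  hf.inner ((continuous_matVec M).comp hg)

theorem bil_eq_dotProduct (M : Matrix (Fin d) (Fin d) ℝ) (x y : Vec d) :
    bil M x y = x.ofLp ⬝ᵥ (M *ᵥ y.ofLp) := by
  simp [bil, matVec, EuclideanSpace.inner_eq_star_dotProduct, dotProduct_comm]

theorem bil_add_left (M : Matrix (Fin d) (Fin d) ℝ) (x y z : Vec d) :
    bil M (x + y) z = bil M x z + bil M y z := inner_add_left _ _ _

theorem bil_smul_left (M : Matrix (Fin d) (Fin d) ℝ) (c : ℝ) (x z : Vec d) :
    bil M (c • x) z = c * bil M x z := real_inner_smul_left _ _ _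

theorem bil_matrix_sub (M N : Matrix (Fin d) (Fin d) ℝ) (x y : Vec d) :
    bil (M - N) x y = bil M x y - bil N x y := by
  simp [bil_eq_dotProduct, Matrix.sub_mulVec]

theorem bil_matrix_smul (M : Matrix (Fin d) (Fin d) ℝ) (c : ℝ) (x y : Vec d) :
    bil (c • M) x y = c * bil M x y := by
  simp [bil_eq_dotProduct, Matrix.smul_mulVec]

theorem bil_comm {M : Matrix (Fin d) (Fin d) ℝ} (hM : M.PosDef) (x y : Vec d) :
    bil M x y = bil M y x := by
  have h : Mᵀ = M := by simpa using hM.isHermitian.eq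
  rw [bil_eq_dotProduct, bil_eq_dotProduct, Matrix.dotProduct_mulVec, dotProduct_comm,
    ← Matrix.mulVec_transpose, h]

theorem abs_bil_le (M : Matrix (Fin d) (Fin d) ℝ) (x y : Vec d) :
    |bil M x y| ≤ ‖Matrix.toEuclideanCLM (𝕜 := ℝ) M‖ * ‖x‖ * ‖y‖ := by
  have h := abs_real_inner_le_norm x (matVec M y)
  have h2 := (Matrix.toEuclideanCLM (𝕜 := ℝ) M).le_opNorm y
  rw [← matVec_eq_clm] at h2
  calc |bil M x y| ≤ ‖x‖ * ‖matVec M y‖ := h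
    _ ≤ ‖x‖ * (‖Matrix.toEuclideanCLM (𝕜 := ℝ) M‖ * ‖y‖) := by gcongr
    _ = _ := by ring

/-- The constant is the minimum of the quadratic form on the unit sphere; homogeneity does the rest.
-/
theorem exists_pos_mul_sq_le_bil {M : Matrix (Fin d) (Fin d) ℝ} (hM : M.PosDef) :
    ∃ c : ℝ, 0 < c ∧ ∀ x, c * ‖x‖ ^ 2 ≤ bil M x x := by
  have hpos : ∀ x : Vec d, x ≠ 0 → 0 < bil M x x := fun x hx => by
    have := hM.dotProduct_mulVec_pos (x := x.ofLp) (by simpa using hx)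
    simpa [bil_eq_dotProduct] using this
  have hcont : Continuous fun x : Vec d => bil M x x := continuous_bil M continuous_id continuous_id
  rcases (Metric.sphere (0 : Vec d) 1).eq_empty_or_nonempty with hs | hs
  -- The sphere is empty when `d = 0`; the space is then a point and any constant works.
  · refine ⟨1, one_pos, fun x => ?_⟩
    have hx : x = 0 := by
      by_contra hx
      have : (‖x‖⁻¹ • x) ∈ Metric.sphere (0 : Vec d) 1 := by
        simp [norm_smul, norm_ne_zero_iff.2 hx]
      simp [hs] at this
    subst hx
    simp [bil]
  · obtain ⟨u, hu, hmin⟩ := (isCompact_sphere (0 : Vec d) 1).exists_isMinOn hs hcont.continuousOn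
    have hu1 : ‖u‖ = 1 := by simpa using hu
    refine ⟨bil M u u, hpos u (by rintro rfl; simp at hu1), fun x => ?_⟩
    by_cases hx : x = 0
    · subst hx
      simp [bil]
    have hn : ‖x‖ ≠ 0 := norm_ne_zero_iff.2 hx
    have hmem : (‖x‖⁻¹ • x) ∈ Metric.sphere (0 : Vec d) 1 := by simp [norm_smul, hn]
    have h1 : bil M u u ≤ bil M (‖x‖⁻¹ • x) (‖x‖⁻¹ • x) := hmin hmem
    have h2 : bil M (‖x‖⁻¹ • x) (‖x‖⁻¹ • x) = (‖x‖ ^ 2)⁻¹ * bil M x x := by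
      rw [bil_smul_left, bil_comm hM, bil_smul_left]
      field_simp
    rw [h2, inv_mul_eq_div, le_div_iff₀ (by positivity)] at h1
    exact h1

/-! ### Functions of at most exponential growth -/

/-- The function is bounded by `exp (K (1 + |x|))` for some `K`. -/
def ExpGrowth {F : Type*} [Norm F] (f : Vec d → F) : Prop :=
  ∃ K : ℝ, ∀ x, ‖f x‖ ≤ Real.exp (K * (1 + ‖x‖))

namespace ExpGrowth

variable {F : Type*} [SeminormedAddCommGroup F]

theorem mono {G : Type*} [Norm G] {f : Vec d → F} {g : Vec d → G} (hg : ExpGrowth g)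
    (h : ∀ x, ‖f x‖ ≤ ‖g x‖) : ExpGrowth f :=
  hg.imp fun _ hK x => (h x).trans (hK x)

theorem const (c : F) : ExpGrowth fun _ : Vec d => c := by
  refine ⟨‖c‖, fun x => ?_⟩
  have h1 := Real.add_one_le_exp (‖c‖ * (1 + ‖x‖))
  nlinarith [norm_nonneg c, norm_nonneg x, mul_nonneg (norm_nonneg c) (norm_nonneg x)]

theorem norm_id : ExpGrowth fun x : Vec d => ‖x‖ :=
  ⟨1, fun x => by
    have h1 := Real.add_one_le_exp (1 * (1 + ‖x‖))
    simp only [norm_norm]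
    linarith⟩

theorem norm {f : Vec d → F} (hf : ExpGrowth f) : ExpGrowth fun x => ‖f x‖ :=
  hf.mono fun x => by simp

theorem abs {f : Vec d → ℝ} (hf : ExpGrowth f) : ExpGrowth fun x => |f x| := hf.norm

theorem add {f g : Vec d → F} (hf : ExpGrowth f) (hg : ExpGrowth g) :
    ExpGrowth fun x => f x + g x := by
  obtain ⟨K, hK⟩ := hf
  obtain ⟨K', hK'⟩ := hg
  refine ⟨|K| + |K'| + 1, fun x => ?_⟩
  have hx := norm_nonneg x
  have h1 : Real.exp (K * (1 + ‖x‖)) ≤ Real.exp ((|K| + |K'|) * (1 + ‖x‖)) := by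
    gcongr
    linarith [le_abs_self K, abs_nonneg K']
  have h2 : Real.exp (K' * (1 + ‖x‖)) ≤ Real.exp ((|K| + |K'|) * (1 + ‖x‖)) := by
    gcongr
    linarith [le_abs_self K', abs_nonneg K]
  -- Absorbs the factor 2 from the two summands; this is the extra `1` in the witness.
  have h3 : (2 : ℝ) ≤ Real.exp (1 + ‖x‖) := by
    linarith [Real.add_one_le_exp (1 + ‖x‖)]
  calc ‖f x + g x‖ ≤ ‖f x‖ + ‖g x‖ := norm_add_le _ _
    _ ≤ Real.exp ((|K| + |K'|) * (1 + ‖x‖)) * 2 := by linarith [hK x, hK' x]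
    _ ≤ Real.exp ((|K| + |K'|) * (1 + ‖x‖)) * Real.exp (1 + ‖x‖) := by gcongr
    _ = _ := by rw [← Real.exp_add]; ring_nf

theorem neg {f : Vec d → F} (hf : ExpGrowth f) : ExpGrowth fun x => -f x :=
  hf.mono fun x => by simp

theorem sub {f g : Vec d → F} (hf : ExpGrowth f) (hg : ExpGrowth g) :
    ExpGrowth fun x => f x - g x := by
  simpa only [sub_eq_add_neg] using hf.add hg.neg

theorem mul {f g : Vec d → ℝ} (hf : ExpGrowth f) (hg : ExpGrowth g) :
    ExpGrowth fun x => f x * g x := by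
  obtain ⟨K, hK⟩ := hf
  obtain ⟨K', hK'⟩ := hg
  refine ⟨K + K', fun x => ?_⟩
  rw [norm_mul, add_mul, Real.exp_add]
  gcongr
  · exact hK x
  · exact hK' x

theorem id : ExpGrowth fun x : Vec d => x := norm_id.mono fun x => by simp

theorem inner {f g : Vec d → Vec d} (hf : ExpGrowth f) (hg : ExpGrowth g) :
    ExpGrowth fun x => Inner.inner ℝ (f x) (g x) :=
  (hf.norm.mul hg.norm).mono fun x => by
    simpa using abs_real_inner_le_norm (f x) (g x)

theorem bil (M : Matrix (Fin d) (Fin d) ℝ) {f g : Vec d → Vec d} (hf : ExpGrowth f)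
    (hg : ExpGrowth g) : ExpGrowth fun x => bil M (f x) (g x) :=
  (((const ‖Matrix.toEuclideanCLM (𝕜 := ℝ) M‖).mul hf.norm).mul hg.norm).mono fun x => by
    simpa using abs_bil_le M (f x) (g x)

end ExpGrowth

/-- A function of exponential growth times a function with Gaussian decay is integrable. -/
theorem ExpGrowth.integrable_smul [MeasurableSpace Ω] {P : Measure Ω} [IsFiniteMeasure P]
    {F : Type*} [NormedAddCommGroup F] [NormedSpace ℝ F] {f : Vec d → F}
    (hf : ExpGrowth f) (hfc : Continuous f) {u : Vec d → ℝ} (huc : Continuous u) {c K : ℝ}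
    (hc : 0 < c) (hu : ∀ x, |u x| ≤ Real.exp (-c * ‖x‖ ^ 2 + K * ‖x‖)) {Y : Ω → Vec d}
    (hY : AEStronglyMeasurable Y P) : Integrable (fun ω => u (Y ω) • f (Y ω)) P := by
  obtain ⟨K', hK'⟩ := hf
  -- The constant bounds `K' + (K + K') r - c r ^ 2` over all `r`, by completing the square.
  refine Integrable.of_bound (C := Real.exp (K' + (K + K') ^ 2 / (4 * c)))
    ((huc.smul hfc).comp_aestronglyMeasurable hY) (ae_of_all _ fun ω => ?_)
  rw [norm_smul, Real.norm_eq_abs]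
  refine (mul_le_mul (hu _) (hK' _) (norm_nonneg _) (Real.exp_pos _).le).trans ?_
  rw [← Real.exp_add, Real.exp_le_exp]
  have h : (K + K') ^ 2 / (4 * c) - ((K + K') * ‖Y ω‖ - c * ‖Y ω‖ ^ 2)
      = (2 * c * ‖Y ω‖ - (K + K')) ^ 2 / (4 * c) := by field_simp; ring
  have h2 : 0 ≤ (2 * c * ‖Y ω‖ - (K + K')) ^ 2 / (4 * c) := by positivity
  nlinarith

/-! ### CRRA utility -/

theorem deriv_crra {η w : ℝ} (hw : 0 < w) : deriv (crra η) w = w ^ (-η) := by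
  by_cases h : η = 1
  · have : crra η = Real.log := by funext w; simp [crra, h]
    rw [this, Real.deriv_log, h, Real.rpow_neg_one]
  · have h1 : 1 - η ≠ 0 := sub_ne_zero.2 (Ne.symm h)
    have : crra η = fun w => w ^ (1 - η) / (1 - η) := by funext w; simp [crra, h]
    rw [this, ((Real.hasDerivAt_rpow_const (p := 1 - η) (Or.inl hw.ne')).div_const _).deriv,
      mul_div_cancel_left₀ _ h1]
    congr 1
    ring

/-- Marginal utility `w ^ (-η)` is injective on the positive axis, so the inverse chosen by
`invFunOn` is forced. The exponential form of `z ^ (-1/η)` suits the variable `log z` used below. -/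
theorem invMarginal_crra {η z : ℝ} (hη : 0 < η) (hz : 0 < z) :
    invMarginal (crra η) z = Real.exp (-Real.log z / η) := by
  have hex : ∃ w ∈ Ioi (0 : ℝ), deriv (crra η) w = z := by
    refine ⟨Real.exp (-Real.log z / η), Real.exp_pos _, ?_⟩
    rw [deriv_crra (Real.exp_pos _), ← Real.exp_mul]
    have : -Real.log z / η * -η = Real.log z := by field_simp
    rw [this, Real.exp_log hz]
  obtain ⟨hpos, heq⟩ := Function.invFunOn_pos hex
  change 0 < invMarginal (crra η) z at hpos
  change deriv (crra η) (invMarginal (crra η) z) = z at heq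
  rw [deriv_crra hpos] at heq
  have hlog := congrArg Real.log heq
  rw [Real.log_rpow hpos] at hlog
  rw [← hlog]
  have : -(-η * Real.log (invMarginal (crra η) z)) / η = Real.log (invMarginal (crra η) z) := by
    field_simp
  rw [this, Real.exp_log hpos]

/-! ### The logarithm of the unnormalized pricing density -/

/-- The left-hand side of the clearing equation as a function of `log z`. -/
noncomputable def clearingMap (w α η l : ℝ) : ℝ := w * Real.exp (-l / η) - α * l

/-- The inverse function of `clearingMap`. -/
noncomputable def logClearing (w α η : ℝ) : ℝ → ℝ := Function.invFun (clearingMap w α η)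

section Scalar

variable {w α η : ℝ}

theorem continuous_clearingMap : Continuous (clearingMap w α η) := by
  unfold clearingMap
  fun_prop

/-- The exponential term is decreasing, so the slope is at most `-α` whatever `η` is. Injectivity
and the Lipschitz bound for the inverse follow. -/
theorem mul_sub_le_clearingMap_sub (hw : 0 < w) (hη : 0 < η) {l l' : ℝ} (h : l ≤ l') :
    α * (l' - l) ≤ clearingMap w α η l - clearingMap w α η l' := by
  have : Real.exp (-l' / η) ≤ Real.exp (-l / η) := by gcongr
  unfold clearingMap
  nlinarith

theorem mul_abs_sub_le (hw : 0 < w) (hη : 0 < η) (l l' : ℝ) :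
    α * |l - l'| ≤ |clearingMap w α η l - clearingMap w α η l'| := by
  rcases le_total l l' with h | h
  · have := mul_sub_le_clearingMap_sub (α := α) hw hη h
    rw [abs_sub_comm, abs_of_nonneg (sub_nonneg.2 h)]
    exact this.trans (le_abs_self _)
  · have := mul_sub_le_clearingMap_sub (α := α) hw hη h
    rw [abs_of_nonneg (sub_nonneg.2 h), abs_sub_comm (clearingMap w α η l)]
    exact this.trans (le_abs_self _)

theorem clearingMap_injective (hw : 0 < w) (hα : 0 < α) (hη : 0 < η) :
    Function.Injective (clearingMap w α η) := fun l l' h => by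
  have := mul_abs_sub_le (α := α) hw hη l l'
  rw [h, sub_self, abs_zero] at this
  have h2 : |l - l'| ≤ 0 := by
    by_contra! h3
    nlinarith
  exact sub_eq_zero.1 (abs_nonpos_iff.1 h2)

theorem clearingMap_surjective (hw : 0 < w) (hα : 0 < α) (hη : 0 < η) :
    Function.Surjective (clearingMap w α η) := by
  refine continuous_clearingMap.surjective' ?_ ?_
  · refine tendsto_atTop_mono (f := fun l => -(α * l)) (fun l => ?_) ?_
    · have := mul_pos hw (Real.exp_pos (-l / η))
      unfold clearingMap
      linarith
    · exact tendsto_neg_atBot_atTop.comp (tendsto_id.const_mul_atBot hα)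
  · refine tendsto_atBot_mono' (f₂ := clearingMap w α η) (f₁ := fun l => w - α * l) _
      ?_ ?_
    · filter_upwards [eventually_ge_atTop 0] with l hl
      have : Real.exp (-l / η) ≤ 1 := by
        rw [Real.exp_le_one_iff]
        exact div_nonpos_of_nonpos_of_nonneg (by linarith) hη.le
      unfold clearingMap
      nlinarith
    · exact tendsto_atBot_add_const_left _ w
        (tendsto_neg_atTop_atBot.comp (tendsto_id.const_mul_atTop hα))

theorem clearingMap_logClearing (hw : 0 < w) (hα : 0 < α) (hη : 0 < η) (s : ℝ) :
    clearingMap w α η (logClearing w α η s) = s :=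
  Function.rightInverse_invFun (clearingMap_surjective hw hα hη) s

theorem logClearing_clearingMap (hw : 0 < w) (hα : 0 < α) (hη : 0 < η) (l : ℝ) :
    logClearing w α η (clearingMap w α η l) = l :=
  Function.leftInverse_invFun (clearingMap_injective hw hα hη) l

theorem abs_logClearing_sub_le (hw : 0 < w) (hα : 0 < α) (hη : 0 < η) (s s' : ℝ) :
    |logClearing w α η s - logClearing w α η s'| ≤ |s - s'| / α := by
  rw [le_div_iff₀ hα, mul_comm]
  simpa only [clearingMap_logClearing hw hα hη] using
    mul_abs_sub_le (α := α) hw hη (logClearing w α η s) (logClearing w α η s')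

theorem continuous_logClearing (hw : 0 < w) (hα : 0 < α) (hη : 0 < η) :
    Continuous (logClearing w α η) := by
  refine (LipschitzWith.of_dist_le_mul (K := ⟨α⁻¹, (inv_pos.2 hα).le⟩) fun s s' => ?_).continuous
  rw [Real.dist_eq, Real.dist_eq]
  refine (abs_logClearing_sub_le hw hα hη s s').trans_eq ?_
  rw [div_eq_inv_mul]
  rfl

/-- Difference of the clearing equations at `s + k` and at `k`. In the applications `s = ϑ(x, h)`
and `k = κ`; the bounds below are read off from the signs of the two sides. -/
theorem logClearing_sub_eq (hw : 0 < w) (hα : 0 < α) (hη : 0 < η) (s k : ℝ) :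
    α * (logClearing w α η (s + k) - logClearing w α η k) + s
      = w * (Real.exp (-logClearing w α η (s + k) / η) - Real.exp (-logClearing w α η k / η)) := by
  have h1 := clearingMap_logClearing hw hα hη (s + k)
  have h2 := clearingMap_logClearing hw hα hη k
  unfold clearingMap at h1 h2
  linarith

theorem abs_logClearing_shift_le (hw : 0 < w) (hα : 0 < α) (hη : 0 < η) (s k : ℝ) :
    |logClearing w α η (s + k) - logClearing w α η k| ≤ |s| / α := by
  simpa using abs_logClearing_sub_le hw hα hη (s + k) k

/-- If the increment of `logClearing` is positive, the right side of `logClearing_sub_eq` is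
nonpositive, so the increment is at most `-s / α`. The bound is free of `η` and `k`, as dominated
convergence requires. -/
theorem exp_logClearing_sub_le (hw : 0 < w) (hα : 0 < α) (hη : 0 < η) (s k : ℝ) :
    Real.exp (logClearing w α η (s + k) - logClearing w α η k) ≤ 1 + Real.exp (-s / α) := by
  have h := logClearing_sub_eq hw hα hη s k
  rcases le_total (logClearing w α η (s + k)) (logClearing w α η k) with h1 | h1
  · have : Real.exp (logClearing w α η (s + k) - logClearing w α η k) ≤ 1 :=
      Real.exp_le_one_iff.2 (sub_nonpos.2 h1)
    linarith [Real.exp_pos (-s / α)]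
  · have h2 : Real.exp (-logClearing w α η (s + k) / η) ≤ Real.exp (-logClearing w α η k / η) := by
      gcongr
    have h3 : logClearing w α η (s + k) - logClearing w α η k ≤ -s / α := by
      rw [le_div_iff₀ hα]
      nlinarith
    linarith [Real.exp_le_exp.2 h3]

/-- If the increment is negative, `logClearing_sub_eq` bounds the gain in wealth by `s / w`. Being
linear in `|s|`, the bound keeps exponential growth when `s = ϑ`; the Lipschitz estimate alone would
put `ϑ`, which may itself grow exponentially, into an exponent. -/
theorem exp_neg_logClearing_div_le (hw : 0 < w) (hα : 0 < α) (hη : 0 < η) (s k : ℝ) :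
    Real.exp (-logClearing w α η (s + k) / η)
      ≤ Real.exp (-logClearing w α η k / η) + |s| / w := by
  have h := logClearing_sub_eq hw hα hη s k
  rcases le_total (logClearing w α η k) (logClearing w α η (s + k)) with h1 | h1
  · have h2 : Real.exp (-logClearing w α η (s + k) / η) ≤ Real.exp (-logClearing w α η k / η) := by
      gcongr
    linarith [div_nonneg (abs_nonneg s) hw.le]
  · have h3 : Real.exp (-logClearing w α η (s + k) / η) - Real.exp (-logClearing w α η k / η)
        ≤ |s| / w := by
      rw [le_div_iff₀ hw]
      nlinarith [le_abs_self s]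
    linarith

theorem exp_neg_logClearing_div_eq (s k : ℝ) :
    Real.exp (-logClearing w α η (s + k) / η) = Real.exp (-logClearing w α η k / η)
      * Real.exp (-(logClearing w α η (s + k) - logClearing w α η k) / η) := by
  rw [← Real.exp_add]
  ring_nf

theorem abs_exp_sub_one_le_exp_abs_sub_one (x : ℝ) : |Real.exp x - 1| ≤ Real.exp |x| - 1 := by
  rcases le_total 0 x with h | h
  · rw [abs_of_nonneg h, abs_of_nonneg]
    linarith [Real.add_one_le_exp x]
  · rw [abs_of_nonpos h, abs_of_nonpos (by linarith [Real.exp_le_one_iff.2 h])]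
    have h1 : Real.exp x * Real.exp (-x) = 1 := by rw [← Real.exp_add]; simp
    nlinarith [sq_nonneg (Real.exp x - 1), Real.exp_pos x, Real.exp_pos (-x),
      Real.exp_le_one_iff.2 h, Real.one_le_exp (neg_nonneg.2 h)]

theorem abs_neg_sub_div_le (hw : 0 < w) (hα : 0 < α) (hη : 0 < η) (s k : ℝ) :
    |-(logClearing w α η (s + k) - logClearing w α η k) / η| ≤ |s| / α / η := by
  rw [abs_div, abs_neg, abs_of_pos hη]
  gcongr
  exact abs_logClearing_shift_le hw hα hη s k

/-- The error in replacing the increment by its limit `-s / α`; it is controlled by the reference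
wealth `exp(-logClearing k / η)`. -/
theorem abs_mul_logClearing_sub_add_le (hw : 0 < w) (hα : 0 < α) (hη : 0 < η) (s k : ℝ) :
    |α * (logClearing w α η (s + k) - logClearing w α η k) + s|
      ≤ w * (Real.exp (-logClearing w α η k / η) * (Real.exp (|s| / α / η) - 1)) := by
  rw [logClearing_sub_eq hw hα hη, exp_neg_logClearing_div_eq s k, ← mul_sub_one, abs_mul, abs_mul,
    abs_of_pos hw, Real.abs_exp]
  gcongr
  refine (abs_exp_sub_one_le_exp_abs_sub_one _).trans ?_
  gcongr
  exact abs_neg_sub_div_le hw hα hη s k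

end Scalar

/-! ### Signs of the parameters and Gaussian decay of the weights. -/

namespace Economy

variable {e : Economy d}

namespace ValidParameters

theorem alphaI_pos (he : e.ValidParameters) : 0 < e.alphaI := div_pos he.omegaI_pos he.gammaI_pos

theorem alphaN_pos (he : e.ValidParameters) : 0 < e.alphaN := div_pos he.omegaN_pos he.gammaN_pos

theorem alpha_pos (he : e.ValidParameters) : 0 < e.alphaI + e.alphaN :=
  add_pos he.alphaI_pos he.alphaN_pos

theorem precI_posDef (he : e.ValidParameters) : e.precI.PosDef := he.covI_posDef.inv

theorem precU_posDef (he : e.ValidParameters) : e.precU.PosDef :=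
  (he.covI_posDef.add_posSemidef (he.covN_posDef.posSemidef.smul (sq_nonneg _))).inv

end ValidParameters

/-! ### The weights -/

theorem ValidPayoff.continuous (hPsi : e.ValidPayoff) : Continuous e.payoff :=
  hPsi.contDiff.continuous

theorem ValidPayoff.expGrowth (hPsi : e.ValidPayoff) : ExpGrowth e.payoff := by
  obtain ⟨K, -, hK⟩ := hPsi.growth
  exact ⟨K, fun x => (hK x).1⟩

theorem continuous_vartheta (hPsi : e.ValidPayoff) (h : Vec d) :
    Continuous fun x => e.vartheta x h := by
  have h0 : Continuous fun x => inner ℝ e.supply (e.payoff x) :=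
    continuous_const.inner hPsi.continuous
  have h1 := continuous_bil e.precI (continuous_id (X := Vec d)) (continuous_const (y := e.muN))
  have h2 := continuous_bil (e.precI - e.precU) (continuous_id (X := Vec d)) continuous_id
  have h3 := continuous_bil ((e.alphaI + e.alphaN * e.tauN) • e.precI
    - (e.alphaI + e.alphaN) • e.precU) (continuous_id (X := Vec d)) (continuous_const (y := h))
  exact ((h0.sub (h1.const_mul _)).add (h2.const_mul _)).sub h3

theorem continuous_chi (hPsi : e.ValidPayoff) (h : Vec d) : Continuous fun x => e.chi x h := by
  have h0 : Continuous fun x => inner ℝ e.supply (e.payoff x) :=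
    continuous_const.inner hPsi.continuous
  have h2 := continuous_bil e.precI (continuous_id (X := Vec d)) continuous_id
  have h3 := continuous_bil e.precI
    (continuous_const (y := (e.alphaI + e.alphaN * e.tauN) • h + e.alphaN • e.muN))
    (continuous_id (X := Vec d))
  exact (h0.add (h2.const_mul _)).sub h3

theorem continuous_signalWeight (h : Vec d) : Continuous fun x => e.signalWeight x h :=
  Real.continuous_exp.comp (((continuous_bil e.precU continuous_id continuous_id).const_mul _).add
    (continuous_bil e.precU continuous_id continuous_const))

/-- The bracket is the logarithm of `signalWeight`. Hence `signalWeight * exp(-ϑ/α) = exp(-χ/α)`: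
the matrix `P_U` drops out of the limit weight. -/
theorem vartheta_eq_chi (he : e.ValidParameters) (x h : Vec d) :
    e.vartheta x h = e.chi x h + (e.alphaI + e.alphaN)
      * (-(1 / 2) * bil e.precU x x + bil e.precU x h) := by
  rw [vartheta, chi, bil_matrix_sub, bil_matrix_sub, bil_matrix_smul, bil_matrix_smul,
    bil_add_left, bil_smul_left, bil_smul_left, bil_comm he.precI_posDef h x,
    bil_comm he.precI_posDef e.muN x]
  ring

theorem limitWeight_eq_signalWeight_mul (x h : Vec d) :
    e.limitWeight h x
      = e.signalWeight x h * Real.exp (-e.vartheta x h / (e.alphaI + e.alphaN)) := by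
  rw [limitWeight, signalWeight, ← Real.exp_add]
  ring_nf

theorem limitWeight_eq_exp_chi (he : e.ValidParameters) (x h : Vec d) :
    e.limitWeight h x = Real.exp (-e.chi x h / (e.alphaI + e.alphaN)) := by
  have := he.alpha_pos.ne'
  rw [limitWeight, vartheta_eq_chi he]
  congr 1
  field_simp
  ring

theorem signalWeight_pos (x h : Vec d) : 0 < e.signalWeight x h := Real.exp_pos _

theorem limitWeight_pos (x h : Vec d) : 0 < e.limitWeight h x := Real.exp_pos _

theorem continuous_limitWeight (hPsi : e.ValidPayoff) (h : Vec d) :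
    Continuous (e.limitWeight h) := by
  simp_rw [funext fun x => limitWeight_eq_signalWeight_mul (e := e) x h]
  exact (continuous_signalWeight h).mul
    (Real.continuous_exp.comp ((continuous_vartheta hPsi h).neg.div_const _))

theorem expGrowth_vartheta (hPsi : e.ValidPayoff) (h : Vec d) :
    ExpGrowth fun x => e.vartheta x h :=
  ((((ExpGrowth.const _).inner hPsi.expGrowth).sub ((ExpGrowth.const _).mul
    (ExpGrowth.bil _ ExpGrowth.id (ExpGrowth.const _)))).add
    ((ExpGrowth.const _).mul (ExpGrowth.bil _ ExpGrowth.id ExpGrowth.id))).sub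
    (ExpGrowth.bil _ ExpGrowth.id (ExpGrowth.const _))

theorem expGrowth_chi (hPsi : e.ValidPayoff) (h : Vec d) : ExpGrowth fun x => e.chi x h :=
  (((ExpGrowth.const _).inner hPsi.expGrowth).add
    ((ExpGrowth.const _).mul (ExpGrowth.bil _ ExpGrowth.id ExpGrowth.id))).sub
    (ExpGrowth.bil _ (ExpGrowth.const _) ExpGrowth.id)

theorem exists_signalWeight_le (he : e.ValidParameters) (h : Vec d) :
    ∃ c K : ℝ, 0 < c ∧ ∀ x, |e.signalWeight x h| ≤ Real.exp (-c * ‖x‖ ^ 2 + K * ‖x‖) := by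
  obtain ⟨c, hc, hcx⟩ := exists_pos_mul_sq_le_bil he.precU_posDef
  refine ⟨c / 2, ‖Matrix.toEuclideanCLM (𝕜 := ℝ) e.precU‖ * ‖h‖, by positivity, fun x => ?_⟩
  rw [abs_of_pos (signalWeight_pos x h), signalWeight, Real.exp_le_exp]
  have h1 := (le_abs_self _).trans (abs_bil_le e.precU x h)
  have h2 := hcx x
  nlinarith

/-- In the form `exp(-χ/α)` the payoff term only helps, since `Π'Ψ > 0`; the quadratic term in `P_I`
supplies the decay and the linear term the constant `K`. -/
theorem exists_limitWeight_le (he : e.ValidParameters) (hPsi : e.ValidPayoff) (h : Vec d) :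
    ∃ c K : ℝ, 0 < c ∧ ∀ x, |e.limitWeight h x| ≤ Real.exp (-c * ‖x‖ ^ 2 + K * ‖x‖) := by
  obtain ⟨c, hc, hcx⟩ := exists_pos_mul_sq_le_bil he.precI_posDef
  have hα := he.alpha_pos
  set v := (e.alphaI + e.alphaN * e.tauN) • h + e.alphaN • e.muN with hv
  refine ⟨c / 2, ‖Matrix.toEuclideanCLM (𝕜 := ℝ) e.precI‖ * ‖v‖ / (e.alphaI + e.alphaN),
    by positivity, fun x => ?_⟩
  rw [abs_of_pos (limitWeight_pos x h), limitWeight_eq_exp_chi he, Real.exp_le_exp,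
    div_le_iff₀ hα, chi, ← hv]
  have h1 := (le_abs_self _).trans (abs_bil_le e.precI v x)
  have h2 := mul_le_mul_of_nonneg_left (hcx x) hα.le
  have h3 := hPsi.supply_payoff_pos x
  have h4 : (-(c / 2) * ‖x‖ ^ 2 + ‖Matrix.toEuclideanCLM (𝕜 := ℝ) e.precI‖ * ‖v‖
      / (e.alphaI + e.alphaN) * ‖x‖) * (e.alphaI + e.alphaN)
      = -(1 / 2) * ((e.alphaI + e.alphaN) * (c * ‖x‖ ^ 2))
        + ‖Matrix.toEuclideanCLM (𝕜 := ℝ) e.precI‖ * ‖v‖ * ‖x‖ := by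
    field_simp
  rw [h4]
  linarith

/-- A common bound, up to constants, for all the pricing densities at the signal `h`. -/
noncomputable def envelope (e : Economy d) (h x : Vec d) : ℝ :=
  e.signalWeight x h + e.limitWeight h x

theorem envelope_pos (h x : Vec d) : 0 < e.envelope h x :=
  add_pos (signalWeight_pos x h) (limitWeight_pos x h)

variable [MeasurableSpace Ω] {P : Measure Ω} [IsProbabilityMeasure P] {Y : Ω → Vec d}

theorem integrable_envelope_smul (he : e.ValidParameters) (hPsi : e.ValidPayoff) (h : Vec d)
    (hY : AEStronglyMeasurable Y P) {F : Type*} [NormedAddCommGroup F] [NormedSpace ℝ F]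
    {f : Vec d → F} (hf : ExpGrowth f) (hfc : Continuous f) :
    Integrable (fun ω => e.envelope h (Y ω) • f (Y ω)) P := by
  obtain ⟨c, K, hc, hK⟩ := exists_signalWeight_le he h
  obtain ⟨c', K', hc', hK'⟩ := exists_limitWeight_le he hPsi h
  have h1 := hf.integrable_smul hfc (continuous_signalWeight h) hc hK hY
  have h2 := hf.integrable_smul hfc (continuous_limitWeight hPsi h) hc' hK' hY
  simp only [envelope, add_smul]
  exact h1.add h2

theorem integrable_envelope_norm (he : e.ValidParameters) (hPsi : e.ValidPayoff) (h : Vec d)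
    (hY : AEStronglyMeasurable Y P) {F : Type*} [NormedAddCommGroup F]
    {f : Vec d → F} (hf : ExpGrowth f) (hfc : Continuous f) :
    Integrable (fun ω => e.envelope h (Y ω) * ‖f (Y ω)‖) P :=
  integrable_envelope_smul he hPsi h hY hf.norm hfc.norm

/-- A weight that is dominated by the envelope integrates all functions of exponential growth. -/
theorem integrable_smul_of_le_envelope (he : e.ValidParameters) (hPsi : e.ValidPayoff) {h : Vec d}
    (hY : AEStronglyMeasurable Y P) {u : Vec d → ℝ} (huc : Continuous u)
    {C : ℝ} (hu : ∀ x, |u x| ≤ C * e.envelope h x) {F : Type*} [NormedAddCommGroup F]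
    [NormedSpace ℝ F] {f : Vec d → F} (hf : ExpGrowth f) (hfc : Continuous f) :
    Integrable (fun ω => u (Y ω) • f (Y ω)) P := by
  refine ((integrable_envelope_norm he hPsi h hY hf hfc).const_mul C).mono'
    ((huc.smul hfc).comp_aestronglyMeasurable hY) (ae_of_all _ fun ω => ?_)
  rw [norm_smul, Real.norm_eq_abs, ← mul_assoc]
  gcongr
  exact hu _

theorem integral_pos_of_pos {f : Ω → ℝ} (hf : ∀ᵐ ω ∂P, 0 < f ω) (hfi : Integrable f P) :
    0 < ∫ ω, f ω ∂P := by
  rw [integral_pos_iff_support_of_nonneg_ae (hf.mono fun _ h => h.le) hfi]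
  have : P (Function.support f) = 1 := by
    rw [← prob_compl_eq_zero_iff₀]
    · refine measure_mono_null (fun ω hω => ?_) hf
      simp only [mem_compl_iff, Function.mem_support, not_not] at hω
      simp [hω]
    · exact hfi.aestronglyMeasurable.aemeasurable.nullMeasurableSet_preimage
        (measurableSet_singleton 0).compl
  simp [this]

/-- A continuous positive weight that is dominated by the envelope defines a price. -/
theorem priceDefined_of_le_envelope (he : e.ValidParameters) (hPsi : e.ValidPayoff) {h : Vec d}
    (hY : AEStronglyMeasurable Y P) {u : Vec d → ℝ} (huc : Continuous u)
    (hpos : ∀ x, 0 < u x) {C : ℝ} (hu : ∀ x, u x ≤ C * e.envelope h x) :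
    e.PriceDefined P Y u := by
  have hu' : ∀ x, |u x| ≤ C * e.envelope h x := fun x => by
    rw [abs_of_pos (hpos x)]
    exact hu x
  have h1 : Integrable (fun ω => u (Y ω)) P := by
    simpa using integrable_smul_of_le_envelope he hPsi hY huc hu' (ExpGrowth.const (1 : ℝ))
      continuous_const
  exact ⟨h1, integral_pos_of_pos (ae_of_all _ fun ω => hpos _) h1,
    integrable_smul_of_le_envelope he hPsi hY huc hu' hPsi.expGrowth hPsi.continuous⟩

/-- Prices ignore normalization, so multipliers and reference values may be discarded. -/
theorem price_const_mul (e : Economy d) (P : Measure Ω) (Y : Ω → Vec d) {c : ℝ} (hc : c ≠ 0)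
    (u : Vec d → ℝ) : e.price P Y (fun x => c * u x) = e.price P Y u := by
  simp only [price, mul_smul, integral_smul, integral_const_mul]
  rw [mul_inv, smul_smul]
  congr 1
  field_simp

theorem limitWeight_le_envelope (h x : Vec d) : e.limitWeight h x ≤ 1 * e.envelope h x := by
  rw [envelope, one_mul]
  linarith [signalWeight_pos (e := e) x h]

theorem priceDefined_limitWeight (he : e.ValidParameters) (hPsi : e.ValidPayoff) (h : Vec d)
    (hY : AEStronglyMeasurable Y P) : e.PriceDefined P Y (e.limitWeight h) :=
  priceDefined_of_le_envelope he hPsi hY (continuous_limitWeight hPsi h)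
    (fun x => limitWeight_pos x h) (limitWeight_le_envelope h)

/-! ### The economy with the two CARA agents -/

/-- The logarithm of the normalized weight is a constant minus `χ/α`, and centering under the
pricing measure removes the constant. -/
theorem clearsCARA_limitWeight (he : e.ValidParameters) (hPsi : e.ValidPayoff) (h : Vec d)
    (hY : AEStronglyMeasurable Y P) :
    e.ClearsCARA P Y h fun x => (∫ ω, e.limitWeight h (Y ω) ∂P)⁻¹ * e.limitWeight h x := by
  obtain ⟨h1, h2, h3⟩ := priceDefined_limitWeight he hPsi h hY
  set c := (∫ ω, e.limitWeight h (Y ω) ∂P)⁻¹ with hc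
  have hcpos : 0 < c := inv_pos.2 h2
  have hα := he.alpha_pos
  have hlog : ∀ x, Real.log (c * e.limitWeight h x)
      = Real.log c + -(e.alphaI + e.alphaN)⁻¹ * e.chi x h := fun x => by
    rw [Real.log_mul hcpos.ne' (limitWeight_pos x h).ne', limitWeight_eq_exp_chi he, Real.log_exp]
    ring
  have hone : ∫ ω, c * e.limitWeight h (Y ω) ∂P = 1 := by
    rw [integral_const_mul, hc, inv_mul_cancel₀ h2.ne']
  have hchi : Integrable (fun ω => c * e.limitWeight h (Y ω) * e.chi (Y ω) h) P := by
    have := integrable_smul_of_le_envelope he hPsi hY (continuous_limitWeight hPsi h)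
      (fun x => (abs_of_pos (limitWeight_pos x h)).trans_le (limitWeight_le_envelope h x))
      (expGrowth_chi hPsi h) (continuous_chi hPsi h)
    simpa only [smul_eq_mul, mul_assoc] using this.const_mul c
  have hsplit : ∀ ω, c * e.limitWeight h (Y ω) * Real.log (c * e.limitWeight h (Y ω))
      = Real.log c * (c * e.limitWeight h (Y ω))
        + -(e.alphaI + e.alphaN)⁻¹ * (c * e.limitWeight h (Y ω) * e.chi (Y ω) h) := fun ω => by
    rw [hlog]
    ring
  refine ⟨fun x => mul_pos hcpos (limitWeight_pos x h), h1.const_mul c, hone, ?_, hchi, ?_, ?_⟩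
  · simp only [mul_smul]
    exact h3.smul c
  · simp only [hsplit]
    exact ((h1.const_mul c).const_mul _).add (hchi.const_mul _)
  · intro x
    simp only [hsplit]
    rw [integral_add ((h1.const_mul c).const_mul _) (hchi.const_mul _),
      integral_const_mul (Real.log c), hone, integral_const_mul, hlog]
    field_simp
    ring

/-- Exponentiating the clearing condition gives `Z` as a constant multiple of the limit weight, as
functions of `x`. The conclusion therefore holds under any law, in particular that of `X_T` given
`X_t = x`. -/
theorem price_eq_of_clearsCARA (he : e.ValidParameters) {h : Vec d} {μ : Measure Ω} {XT : Ω → Vec d}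
    {Z : Vec d → ℝ} (hZ : e.ClearsCARA μ XT h Z) {Ω' : Type*} [MeasurableSpace Ω']
    (P' : Measure Ω') (Y : Ω' → Vec d) : e.price P' Y Z = e.price P' Y (e.limitWeight h) := by
  have hα := he.alpha_pos
  set k := (∫ ω, Z (XT ω) * e.chi (XT ω) h ∂μ) / (e.alphaI + e.alphaN)
    + ∫ ω, Z (XT ω) * Real.log (Z (XT ω)) ∂μ with hk
  have : Z = fun x => Real.exp k * e.limitWeight h x := by
    funext x
    rw [limitWeight_eq_exp_chi he, ← Real.exp_add, ← Real.exp_log (hZ.pos x)]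
    congr 1
    have := hZ.clearing x
    rw [hk]
    field_simp
    linarith
  rw [this, price_const_mul e P' Y (Real.exp_pos k).ne']

end Economy

/-! ### The clearing equation for CRRA utility. -/

namespace Economy

/-- The logarithm of the solution of the clearing equation. -/
noncomputable def logZ (e : Economy d) (η : ℝ) (h : Vec d) (κ : ℝ) (x : Vec d) : ℝ :=
  logClearing e.omegaU (e.alphaI + e.alphaN) η (e.vartheta x h + κ)

/-- The value of `logZ` at a point where `ϑ` vanishes. -/
noncomputable def refLog (e : Economy d) (η κ : ℝ) : ℝ :=
  logClearing e.omegaU (e.alphaI + e.alphaN) η κ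

/-- The pricing density, up to a constant factor. -/
noncomputable def relDensity (e : Economy d) (η : ℝ) (h : Vec d) (κ : ℝ) (x : Vec d) : ℝ :=
  Real.exp (e.logZ η h κ x - e.refLog η κ) * e.signalWeight x h

/-- The terminal wealth of the uninformed agent. -/
noncomputable def wealth (e : Economy d) (η : ℝ) (h : Vec d) (κ : ℝ) (x : Vec d) : ℝ :=
  Real.exp (-e.logZ η h κ x / η)

/-- The expected excess of the endowment over the wealth of the uninformed agent under
`relDensity`. -/
noncomputable def budgetGap (e : Economy d) [MeasurableSpace Ω] (P : Measure Ω) (XT : Ω → Vec d)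
    (η : ℝ) (h : Vec d) (κ : ℝ) : ℝ :=
  ∫ ω, (inner ℝ e.shareU (e.payoff (XT ω)) - e.wealth η h κ (XT ω)) * e.relDensity η h κ (XT ω) ∂P

variable {e : Economy d} {η : ℝ}

theorem clearing_logZ (he : e.ValidParameters) (hη : 0 < η) (x h : Vec d) (κ : ℝ) :
    e.omegaU * e.wealth η h κ x - (e.alphaI + e.alphaN) * e.logZ η h κ x = e.vartheta x h + κ :=
  clearingMap_logClearing he.omegaU_pos he.alpha_pos hη _

/-- Injectivity of `clearingMap` makes the positive solution unique, so the choice operator must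
return this one. -/
theorem clearingZ_crra (he : e.ValidParameters) (hη : 0 < η) (x h : Vec d) (κ : ℝ) :
    e.clearingZ (crra η) x h κ = Real.exp (e.logZ η h κ x) := by
  have hex : ∃ z : ℝ, 0 < z ∧ e.omegaU * invMarginal (crra η) z
      - (e.alphaI + e.alphaN) * Real.log z = e.vartheta x h + κ := by
    refine ⟨Real.exp (e.logZ η h κ x), Real.exp_pos _, ?_⟩
    rw [invMarginal_crra hη (Real.exp_pos _), Real.log_exp]
    exact clearing_logZ he hη x h κ
  obtain ⟨hpos, heq⟩ := Classical.epsilon_spec hex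
  change 0 < e.clearingZ (crra η) x h κ at hpos
  change e.omegaU * invMarginal (crra η) (e.clearingZ (crra η) x h κ)
      - (e.alphaI + e.alphaN) * Real.log (e.clearingZ (crra η) x h κ) = _ at heq
  rw [invMarginal_crra hη hpos] at heq
  rw [← Real.exp_log hpos, logZ, ← heq]
  exact congrArg Real.exp (logClearing_clearingMap he.omegaU_pos he.alpha_pos hη _).symm

theorem invMarginal_clearingZ (he : e.ValidParameters) (hη : 0 < η) (x h : Vec d) (κ : ℝ) :
    invMarginal (crra η) (e.clearingZ (crra η) x h κ) = e.wealth η h κ x := by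
  rw [clearingZ_crra he hη, invMarginal_crra hη (Real.exp_pos _), Real.log_exp, wealth]

theorem clearingZ_mul_signalWeight (he : e.ValidParameters) (hη : 0 < η) (x h : Vec d) (κ : ℝ) :
    e.clearingZ (crra η) x h κ * e.signalWeight x h
      = Real.exp (e.refLog η κ) * e.relDensity η h κ x := by
  rw [clearingZ_crra he hη, relDensity, ← mul_assoc, ← Real.exp_add]
  ring_nf

/-! ### Bounds -/

theorem relDensity_pos (η : ℝ) (h : Vec d) (κ : ℝ) (x : Vec d) : 0 < e.relDensity η h κ x :=
  mul_pos (Real.exp_pos _) (signalWeight_pos x h)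

theorem wealth_pos (η : ℝ) (h : Vec d) (κ : ℝ) (x : Vec d) : 0 < e.wealth η h κ x :=
  Real.exp_pos _

/-- In the bound `1 + exp(-ϑ/α)` of `exp_logClearing_sub_le`, multiplied by the signal weight, the
first term becomes the signal weight and the second the limit weight. -/
theorem relDensity_le_envelope (he : e.ValidParameters) (hη : 0 < η) (h : Vec d) (κ : ℝ)
    (x : Vec d) : e.relDensity η h κ x ≤ e.envelope h x := by
  have h1 := exp_logClearing_sub_le he.omegaU_pos he.alpha_pos hη (e.vartheta x h) κ
  have h2 := mul_le_mul_of_nonneg_right h1 (signalWeight_pos (e := e) x h).le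
  rw [envelope, limitWeight_eq_signalWeight_mul]
  refine h2.trans_eq ?_
  ring

theorem abs_relDensity_le (he : e.ValidParameters) (hη : 0 < η) (h : Vec d) (κ : ℝ)
    (x : Vec d) : |e.relDensity η h κ x| ≤ 1 * e.envelope h x := by
  rw [abs_of_pos (relDensity_pos η h κ x), one_mul]
  exact relDensity_le_envelope he hη h κ x

theorem wealth_le (he : e.ValidParameters) (hη : 0 < η) (h : Vec d) (κ : ℝ) (x : Vec d) :
    e.wealth η h κ x ≤ Real.exp (-e.refLog η κ / η) + |e.vartheta x h| / e.omegaU :=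
  exp_neg_logClearing_div_le he.omegaU_pos he.alpha_pos hη _ _

theorem wealth_eq_mul (η : ℝ) (h : Vec d) (κ : ℝ) (x : Vec d) :
    e.wealth η h κ x = Real.exp (-e.refLog η κ / η)
      * Real.exp (-(e.logZ η h κ x - e.refLog η κ) / η) :=
  exp_neg_logClearing_div_eq _ _

theorem continuous_logZ (he : e.ValidParameters) (hPsi : e.ValidPayoff) (hη : 0 < η) (h : Vec d)
    (κ : ℝ) : Continuous (e.logZ η h κ) :=
  (continuous_logClearing he.omegaU_pos he.alpha_pos hη).comp
    ((continuous_vartheta hPsi h).add continuous_const)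

theorem continuous_relDensity (he : e.ValidParameters) (hPsi : e.ValidPayoff) (hη : 0 < η)
    (h : Vec d) (κ : ℝ) : Continuous (e.relDensity η h κ) :=
  (Real.continuous_exp.comp ((continuous_logZ he hPsi hη h κ).sub continuous_const)).mul
    (continuous_signalWeight h)

theorem continuous_wealth (he : e.ValidParameters) (hPsi : e.ValidPayoff) (hη : 0 < η)
    (h : Vec d) (κ : ℝ) : Continuous (e.wealth η h κ) :=
  Real.continuous_exp.comp ((continuous_logZ he hPsi hη h κ).neg.div_const _)

theorem expGrowth_wealth_bound (hPsi : e.ValidPayoff) (h : Vec d) (M : ℝ) :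
    ExpGrowth fun x => M + |e.vartheta x h| / e.omegaU := by
  simp only [div_eq_mul_inv]
  exact (ExpGrowth.const _).add ((expGrowth_vartheta hPsi h).abs.mul (ExpGrowth.const _))

theorem expGrowth_wealth (he : e.ValidParameters) (hPsi : e.ValidPayoff) (hη : 0 < η)
    (h : Vec d) (κ : ℝ) : ExpGrowth (e.wealth η h κ) :=
  (expGrowth_wealth_bound hPsi h (Real.exp (-e.refLog η κ / η))).mono fun x => by
    rw [Real.norm_of_nonneg (wealth_pos η h κ x).le]
    exact (wealth_le he hη h κ x).trans (le_abs_self _)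

theorem expGrowth_shareU_payoff (hPsi : e.ValidPayoff) :
    ExpGrowth fun x => inner ℝ e.shareU (e.payoff x) :=
  (ExpGrowth.const _).inner hPsi.expGrowth

theorem continuous_shareU_payoff (hPsi : e.ValidPayoff) :
    Continuous fun x => inner ℝ e.shareU (e.payoff x) :=
  continuous_const.inner hPsi.continuous

variable [MeasurableSpace Ω] {P : Measure Ω} [IsProbabilityMeasure P] {Y : Ω → Vec d}

theorem integrable_relDensity_smul (he : e.ValidParameters) (hPsi : e.ValidPayoff) (hη : 0 < η)
    (h : Vec d) (κ : ℝ) (hY : AEStronglyMeasurable Y P) {F : Type*} [NormedAddCommGroup F]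
    [NormedSpace ℝ F] {f : Vec d → F} (hf : ExpGrowth f) (hfc : Continuous f) :
    Integrable (fun ω => e.relDensity η h κ (Y ω) • f (Y ω)) P :=
  integrable_smul_of_le_envelope he hPsi hY (continuous_relDensity he hPsi hη h κ)
    (abs_relDensity_le he hη h κ) hf hfc

theorem priceDefined_relDensity (he : e.ValidParameters) (hPsi : e.ValidPayoff) (hη : 0 < η)
    (h : Vec d) (κ : ℝ) (hY : AEStronglyMeasurable Y P) :
    e.PriceDefined P Y (e.relDensity η h κ) :=
  priceDefined_of_le_envelope he hPsi hY (continuous_relDensity he hPsi hη h κ)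
    (relDensity_pos η h κ) fun x => (le_abs_self _).trans (abs_relDensity_le he hη h κ x)

theorem multiplier_crra (he : e.ValidParameters) (hη : 0 < η) (h : Vec d) (κ : ℝ)
    (P : Measure Ω) (Y : Ω → Vec d) :
    e.multiplier P Y (crra η) h κ
      = Real.exp (e.refLog η κ) * ∫ ω, e.relDensity η h κ (Y ω) ∂P := by
  simp only [multiplier, clearingZ_mul_signalWeight he hη, integral_const_mul]

theorem pricingDensity_crra (he : e.ValidParameters) (hη : 0 < η) (h : Vec d) (κ : ℝ)
    (P : Measure Ω) (Y : Ω → Vec d) :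
    e.pricingDensity P Y (crra η) h κ
      = fun x => (∫ ω, e.relDensity η h κ (Y ω) ∂P)⁻¹ * e.relDensity η h κ x := by
  funext x
  rw [pricingDensity, clearingZ_mul_signalWeight he hη, multiplier_crra he hη,
    mul_div_mul_left _ _ (Real.exp_pos _).ne', div_eq_inv_mul]

theorem budgetHolds_iff (he : e.ValidParameters) (hη : 0 < η) (h : Vec d) (κ : ℝ)
    (P : Measure Ω) (Y : Ω → Vec d) :
    e.BudgetHolds P Y (crra η) h κ ↔ e.budgetGap P Y η h κ = 0 := by
  have : ∀ ω, (inner ℝ e.shareU (e.payoff (Y ω))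
      - invMarginal (crra η) (e.clearingZ (crra η) (Y ω) h κ))
      * e.clearingZ (crra η) (Y ω) h κ * e.signalWeight (Y ω) h
      = Real.exp (e.refLog η κ) * ((inner ℝ e.shareU (e.payoff (Y ω)) - e.wealth η h κ (Y ω))
        * e.relDensity η h κ (Y ω)) := fun ω => by
    rw [mul_assoc, clearingZ_mul_signalWeight he hη, invMarginal_clearingZ he hη]
    ring
  simp only [BudgetHolds, this, integral_const_mul, budgetGap, mul_eq_zero,
    (Real.exp_pos _).ne', false_or]

theorem budgetGap_eq_sub (he : e.ValidParameters) (hPsi : e.ValidPayoff) (hη : 0 < η) (h : Vec d)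
    (κ : ℝ) (hY : AEStronglyMeasurable Y P) :
    e.budgetGap P Y η h κ = inner ℝ e.shareU (∫ ω, e.relDensity η h κ (Y ω) • e.payoff (Y ω) ∂P)
      - ∫ ω, e.relDensity η h κ (Y ω) * e.wealth η h κ (Y ω) ∂P := by
  have h1 := integrable_relDensity_smul he hPsi hη h κ hY hPsi.expGrowth hPsi.continuous
  have h2 : Integrable (fun ω => e.relDensity η h κ (Y ω) * e.wealth η h κ (Y ω)) P :=
    integrable_relDensity_smul he hPsi hη h κ hY (expGrowth_wealth he hPsi hη h κ)
      (continuous_wealth he hPsi hη h κ)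
  rw [← integral_inner h1, ← integral_sub (h1.const_inner _) h2, budgetGap]
  congr 1
  funext ω
  rw [real_inner_smul_right]
  ring

/-! ### Market clearing -/

/-- By `vartheta_eq_chi` the signal weight moves from `ϑ` into the logarithm of the density, so the
clearing equation becomes `χ = w * wealth - α * log Z + const`. Subtracting its expectation under
the pricing measure removes the constant, and the budget constraint identifies expected wealth with
initial wealth. -/
theorem clears_of_budgetHolds (he : e.ValidParameters) (hPsi : e.ValidPayoff) (hη : 0 < η)
    (h : Vec d) (κ : ℝ) (hY : AEStronglyMeasurable Y P)
    (hb : e.BudgetHolds P Y (crra η) h κ) :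
    e.Clears P Y (crra η) h (e.multiplier P Y (crra η) h κ)
      (e.pricingDensity P Y (crra η) h κ) := by
  obtain ⟨h1, h2, h3⟩ := priceDefined_relDensity he hPsi hη h κ hY
  rw [budgetHolds_iff he hη, budgetGap_eq_sub he hPsi hη h κ hY, sub_eq_zero] at hb
  have hα := he.alpha_pos
  have hlam : 0 < e.multiplier P Y (crra η) h κ := by
    rw [multiplier_crra he hη]
    exact mul_pos (Real.exp_pos _) h2
  have hwealth : ∀ x, e.wealthU (crra η) h (e.multiplier P Y (crra η) h κ)
      (e.pricingDensity P Y (crra η) h κ) x = e.wealth η h κ x := fun x => by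
    rw [← invMarginal_clearingZ he hη, wealthU]
    congr 1
    rw [pricingDensity, mul_div_cancel₀ _ hlam.ne', signalWeight, mul_assoc, ← Real.exp_add]
    simp
  have hlog : ∀ x, Real.log (e.pricingDensity P Y (crra η) h κ x)
      = e.logZ η h κ x + Real.log (e.signalWeight x h)
        - Real.log (e.multiplier P Y (crra η) h κ) := fun x => by
    rw [pricingDensity, clearingZ_crra he hη, Real.log_div (mul_pos (Real.exp_pos _)
      (signalWeight_pos x h)).ne' hlam.ne', Real.log_mul (Real.exp_pos _).ne'
      (signalWeight_pos x h).ne', Real.log_exp]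
  have hkey : ∃ k, ∀ x, e.chi x h = e.omegaU * e.wealth η h κ x - (e.alphaI + e.alphaN)
      * Real.log (e.pricingDensity P Y (crra η) h κ x) + k := by
    refine ⟨-κ - (e.alphaI + e.alphaN) * Real.log (e.multiplier P Y (crra η) h κ), fun x => ?_⟩
    have e1 := clearing_logZ he hη x h κ
    rw [vartheta_eq_chi he] at e1
    rw [hlog, signalWeight, Real.log_exp]
    linarith
  obtain ⟨k, hk⟩ := hkey
  have hint : ∀ {F : Type} [NormedAddCommGroup F] [NormedSpace ℝ F] {f : Vec d → F},
      ExpGrowth f → Continuous f →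
        Integrable (fun ω => e.pricingDensity P Y (crra η) h κ (Y ω) • f (Y ω)) P := by
    intro F _ _ f hf hfc
    simp only [pricingDensity_crra he hη, mul_smul]
    exact (integrable_relDensity_smul he hPsi hη h κ hY hf hfc).smul
      ((∫ ω, e.relDensity η h κ (Y ω) ∂P)⁻¹)
  have hpos : ∀ x, 0 < e.pricingDensity P Y (crra η) h κ x := fun x => by
    rw [pricingDensity_crra he hη]
    exact mul_pos (inv_pos.2 h2) (relDensity_pos η h κ x)
  have hone : ∫ ω, e.pricingDensity P Y (crra η) h κ (Y ω) ∂P = 1 := by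
    simp only [pricingDensity_crra he hη, integral_const_mul]
    exact inv_mul_cancel₀ h2.ne'
  have hi1 : Integrable (fun ω => e.pricingDensity P Y (crra η) h κ (Y ω)) P := by
    simpa using hint (ExpGrowth.const (1 : ℝ)) continuous_const
  have hchi : Integrable (fun ω => e.pricingDensity P Y (crra η) h κ (Y ω) * e.chi (Y ω) h) P :=
    hint (expGrowth_chi hPsi h) (continuous_chi hPsi h)
  have hw : Integrable (fun ω => e.pricingDensity P Y (crra η) h κ (Y ω)
      * e.wealth η h κ (Y ω)) P :=
    hint (expGrowth_wealth he hPsi hη h κ) (continuous_wealth he hPsi hη h κ)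
  -- Solving the clearing equation for `log Z` reduces the integrability of `Z log Z` to that of `Z
  -- * wealth`, `Z * χ` and `Z`.
  have hsplit : ∀ ω, e.pricingDensity P Y (crra η) h κ (Y ω)
      * Real.log (e.pricingDensity P Y (crra η) h κ (Y ω))
      = (e.alphaI + e.alphaN)⁻¹ * (e.omegaU
        * (e.pricingDensity P Y (crra η) h κ (Y ω) * e.wealth η h κ (Y ω))
        - e.pricingDensity P Y (crra η) h κ (Y ω) * e.chi (Y ω) h
        + k * e.pricingDensity P Y (crra η) h κ (Y ω)) := fun ω => by
    rw [hk (Y ω)]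
    field_simp
    ring
  have hsub : Integrable (fun ω => e.omegaU
      * (e.pricingDensity P Y (crra η) h κ (Y ω) * e.wealth η h κ (Y ω))
      - e.pricingDensity P Y (crra η) h κ (Y ω) * e.chi (Y ω) h) P := (hw.const_mul _).sub hchi
  have hbudget : ∫ ω, e.pricingDensity P Y (crra η) h κ (Y ω) * e.wealth η h κ (Y ω) ∂P
      = inner ℝ e.shareU (∫ ω, e.pricingDensity P Y (crra η) h κ (Y ω) • e.payoff (Y ω) ∂P) := by
    simp only [pricingDensity_crra he hη, mul_assoc, mul_smul, integral_const_mul, integral_smul,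
      real_inner_smul_right, hb]
  refine ⟨hlam, hpos, hi1, hone, hint hPsi.expGrowth hPsi.continuous, hchi, ?_, ?_, ?_, ?_⟩
  · simp only [hsplit]
    exact (hsub.add (hi1.const_mul _)).const_mul _
  · simpa only [hwealth] using hw
  · simpa only [hwealth] using hbudget
  · intro x
    simp only [hsplit, hwealth]
    rw [integral_const_mul, integral_add hsub (hi1.const_mul _),
      integral_sub (hw.const_mul _) hchi, integral_const_mul, integral_const_mul, hone, hbudget,
      hk x]
    field_simp
    ring

end Economy

namespace Economy

variable {e : Economy d} {η : ℝ}

/-! ### Limits of the pricing densities -/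

/-- The filter is general because there are two uses: `η → ∞` under the budget constraint, and fixed
`η` with `κ` driving the reference wealth to zero. -/
theorem tendsto_relDensity (he : e.ValidParameters) {ι : Type*} {l : Filter ι} {η κ : ι → ℝ}
    (hη : ∀ᶠ i in l, 0 < η i)
    (hlim : ∀ s : ℝ, Tendsto (fun i => Real.exp (-e.refLog (η i) (κ i) / η i)
      * (Real.exp (s / η i) - 1)) l (𝓝 0)) (h x : Vec d) :
    Tendsto (fun i => e.relDensity (η i) h (κ i) x) l (𝓝 (e.limitWeight h x)) := by
  have hα := he.alpha_pos
  have h1 : Tendsto (fun i => (e.alphaI + e.alphaN)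
      * (e.logZ (η i) h (κ i) x - e.refLog (η i) (κ i)) + e.vartheta x h) l (𝓝 0) := by
    refine squeeze_zero_norm' (hη.mono fun i hi =>
      abs_mul_logClearing_sub_add_le he.omegaU_pos hα hi (e.vartheta x h) (κ i)) ?_
    simpa [refLog] using (hlim (|e.vartheta x h| / (e.alphaI + e.alphaN))).const_mul e.omegaU
  have h2 : Tendsto (fun i => e.logZ (η i) h (κ i) x - e.refLog (η i) (κ i)) l
      (𝓝 (-e.vartheta x h / (e.alphaI + e.alphaN))) := by
    have := (h1.sub_const (e.vartheta x h)).div_const (e.alphaI + e.alphaN)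
    rw [zero_sub] at this
    refine this.congr fun i => ?_
    field_simp
    ring
  rw [limitWeight_eq_signalWeight_mul, mul_comm]
  exact ((Real.continuous_exp.tendsto _).comp h2).mul_const _

variable [MeasurableSpace Ω] {P : Measure Ω} [IsProbabilityMeasure P] {Y : Ω → Vec d}

theorem tendsto_integral_relDensity_smul (he : e.ValidParameters) (hPsi : e.ValidPayoff)
    {ι : Type*} {l : Filter ι} [l.IsCountablyGenerated] {η κ : ι → ℝ} (hη : ∀ᶠ i in l, 0 < η i)
    (hlim : ∀ s : ℝ, Tendsto (fun i => Real.exp (-e.refLog (η i) (κ i) / η i)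
      * (Real.exp (s / η i) - 1)) l (𝓝 0)) (h : Vec d) (hY : AEStronglyMeasurable Y P)
    {F : Type*} [NormedAddCommGroup F] [NormedSpace ℝ F] {f : Vec d → F} (hf : ExpGrowth f)
    (hfc : Continuous f) :
    Tendsto (fun i => ∫ ω, e.relDensity (η i) h (κ i) (Y ω) • f (Y ω) ∂P) l
      (𝓝 (∫ ω, e.limitWeight h (Y ω) • f (Y ω) ∂P)) := by
  refine tendsto_integral_filter_of_dominated_convergence
    (fun ω => e.envelope h (Y ω) * ‖f (Y ω)‖) ?_ ?_
    (integrable_envelope_norm he hPsi h hY hf hfc) ?_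
  · exact hη.mono fun i hi =>
      (integrable_relDensity_smul he hPsi hi h (κ i) hY hf hfc).aestronglyMeasurable
  · refine hη.mono fun i hi => ae_of_all _ fun ω => ?_
    rw [norm_smul, Real.norm_of_nonneg (relDensity_pos _ _ _ _).le]
    gcongr
    exact relDensity_le_envelope he hi h (κ i) _
  · exact ae_of_all _ fun ω => (tendsto_relDensity he hη hlim h (Y ω)).smul_const _

theorem tendsto_price_relDensity (he : e.ValidParameters) (hPsi : e.ValidPayoff)
    {ι : Type*} {l : Filter ι} [l.IsCountablyGenerated] {η κ : ι → ℝ} (hη : ∀ᶠ i in l, 0 < η i)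
    (hlim : ∀ s : ℝ, Tendsto (fun i => Real.exp (-e.refLog (η i) (κ i) / η i)
      * (Real.exp (s / η i) - 1)) l (𝓝 0)) (h : Vec d) (hY : AEStronglyMeasurable Y P) :
    Tendsto (fun i => e.price P Y (e.relDensity (η i) h (κ i))) l
      (𝓝 (e.price P Y (e.limitWeight h))) := by
  have h1 := tendsto_integral_relDensity_smul he hPsi hη hlim h hY
    (ExpGrowth.const (1 : ℝ)) continuous_const
  simp only [smul_eq_mul, mul_one] at h1
  exact (h1.inv₀ (priceDefined_limitWeight he hPsi h hY).2.1.ne').smul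
    (tendsto_integral_relDensity_smul he hPsi hη hlim h hY hPsi.expGrowth hPsi.continuous)

/-! ### The budget constraint -/

theorem integrable_budget_bound (he : e.ValidParameters) (hPsi : e.ValidPayoff) (h : Vec d)
    (hY : AEStronglyMeasurable Y P) (M : ℝ) :
    Integrable (fun ω => e.envelope h (Y ω) * (|inner ℝ e.shareU (e.payoff (Y ω))|
      + (M + |e.vartheta (Y ω) h| / e.omegaU))) P :=
  integrable_envelope_smul he hPsi h hY
    ((expGrowth_shareU_payoff hPsi).abs.add (expGrowth_wealth_bound hPsi h M))
    ((continuous_shareU_payoff hPsi).abs.add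
      (continuous_const.add ((continuous_vartheta hPsi h).abs.div_const _)))

theorem norm_budget_integrand_le (he : e.ValidParameters) (hη : 0 < η) (h : Vec d) {κ M : ℝ}
    (hM : Real.exp (-e.refLog η κ / η) ≤ M) (x : Vec d) :
    ‖(inner ℝ e.shareU (e.payoff x) - e.wealth η h κ x) * e.relDensity η h κ x‖
      ≤ e.envelope h x * (|inner ℝ e.shareU (e.payoff x)|
        + (M + |e.vartheta x h| / e.omegaU)) := by
  have h1 := wealth_le he hη h κ x
  have h2 := relDensity_le_envelope he hη h κ x
  rw [norm_mul, Real.norm_of_nonneg (relDensity_pos _ _ _ _).le, mul_comm, Real.norm_eq_abs]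
  refine mul_le_mul h2 ((abs_sub _ _).trans ?_) (abs_nonneg _) (envelope_pos h x).le
  rw [abs_of_pos (wealth_pos η h κ x)]
  linarith

theorem aestronglyMeasurable_budget_integrand (he : e.ValidParameters) (hPsi : e.ValidPayoff)
    (hη : 0 < η) (h : Vec d) (κ : ℝ) {μ : Measure Ω} (hY : AEStronglyMeasurable Y μ) :
    AEStronglyMeasurable (fun ω => (inner ℝ e.shareU (e.payoff (Y ω)) - e.wealth η h κ (Y ω))
      * e.relDensity η h κ (Y ω)) μ :=
  (((continuous_shareU_payoff hPsi).sub (continuous_wealth he hPsi hη h κ)).mul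
    (continuous_relDensity he hPsi hη h κ)).comp_aestronglyMeasurable hY

theorem continuous_budgetGap (he : e.ValidParameters) (hPsi : e.ValidPayoff) (hη : 0 < η)
    (h : Vec d) (hY : AEStronglyMeasurable Y P) : Continuous (e.budgetGap P Y η h) := by
  have hL := continuous_logClearing he.omegaU_pos he.alpha_pos hη
  rw [continuous_iff_continuousAt]
  intro κ₀
  have hW : Continuous fun κ => Real.exp (-e.refLog η κ / η) :=
    Real.continuous_exp.comp (hL.neg.div_const _)
  refine continuousAt_of_dominated (bound := fun ω => e.envelope h (Y ω)
    * (|inner ℝ e.shareU (e.payoff (Y ω))|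
      + (Real.exp (-e.refLog η κ₀ / η) + 1 + |e.vartheta (Y ω) h| / e.omegaU))) ?_ ?_
    (integrable_budget_bound he hPsi h hY _) ?_
  · exact Eventually.of_forall fun κ => aestronglyMeasurable_budget_integrand he hPsi hη h κ hY
  -- Near `κ₀` the reference wealth stays below its value at `κ₀` plus one, so a single dominating
  -- function serves the whole neighbourhood.
  · filter_upwards [hW.continuousAt.eventually_lt_const
      (lt_add_one (Real.exp (-e.refLog η κ₀ / η)))] with κ hκ
    exact ae_of_all _ fun ω => norm_budget_integrand_le he hη h hκ.le _
  · refine ae_of_all _ fun ω => Continuous.continuousAt ?_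
    have h1 : Continuous fun κ => e.logZ η h κ (Y ω) :=
      hL.comp (continuous_const.add continuous_id)
    have h2 : Continuous fun κ => e.refLog η κ := hL
    unfold wealth relDensity
    fun_prop

/-- For a wealthy uninformed agent the budget is exceeded. -/
theorem wealth_bound_of_budgetGap_nonneg (he : e.ValidParameters) (hPsi : e.ValidPayoff)
    (hη : 0 < η) {m : ℝ} (hm : |1 - 1 / η| ≤ m) (h : Vec d) {κ : ℝ}
    (hY : AEStronglyMeasurable Y P) (hgap : 0 ≤ e.budgetGap P Y η h κ) :
    Real.exp (-e.refLog η κ / η) * ∫ ω, Real.exp (-(m * (|e.vartheta (Y ω) h|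
        / (e.alphaI + e.alphaN)))) * e.signalWeight (Y ω) h ∂P
      ≤ ∫ ω, e.envelope h (Y ω) * |inner ℝ e.shareU (e.payoff (Y ω))| ∂P := by
  have hα := he.alpha_pos
  have hm0 : 0 ≤ m := (abs_nonneg _).trans hm
  have hp : Integrable (fun ω => e.relDensity η h κ (Y ω)
      * inner ℝ e.shareU (e.payoff (Y ω))) P :=
    integrable_relDensity_smul he hPsi hη h κ hY (expGrowth_shareU_payoff hPsi)
      (continuous_shareU_payoff hPsi)
  have hw : Integrable (fun ω => e.relDensity η h κ (Y ω) * e.wealth η h κ (Y ω)) P :=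
    integrable_relDensity_smul he hPsi hη h κ hY (expGrowth_wealth he hPsi hη h κ)
      (continuous_wealth he hPsi hη h κ)
  have hle : ∫ ω, e.relDensity η h κ (Y ω) * e.wealth η h κ (Y ω) ∂P
      ≤ ∫ ω, e.relDensity η h κ (Y ω) * inner ℝ e.shareU (e.payoff (Y ω)) ∂P := by
    rw [← sub_nonneg, ← integral_sub hp hw]
    refine hgap.trans_eq (integral_congr_ae (ae_of_all _ fun ω => ?_))
    simp only
    ring
  rw [← integral_const_mul]
  refine (integral_mono_of_nonneg (ae_of_all _ fun ω => ?_) hw (ae_of_all _ fun ω => ?_)).trans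
    (hle.trans (integral_mono hp (integrable_envelope_norm he hPsi h hY
      (expGrowth_shareU_payoff hPsi) (continuous_shareU_payoff hPsi)) fun ω => ?_))
  · exact mul_nonneg (Real.exp_pos _).le (mul_nonneg (Real.exp_pos _).le (signalWeight_pos _ _).le)
  · simp only
    set D := e.logZ η h κ (Y ω) - e.refLog η κ with hD
    have hDle : |D| ≤ |e.vartheta (Y ω) h| / (e.alphaI + e.alphaN) :=
      abs_logClearing_shift_le he.omegaU_pos hα hη _ _
    -- The density contributes `exp D` and the wealth `exp(-D/η)`; the combined exponent `(1 - 1/η)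
    -- D` is bounded below independently of `κ`, and of `η` once `m` is fixed.
    have h1 : -(m * (|e.vartheta (Y ω) h| / (e.alphaI + e.alphaN))) ≤ D + -D / η := by
      have : |(1 - 1 / η) * D| ≤ m * (|e.vartheta (Y ω) h| / (e.alphaI + e.alphaN)) := by
        rw [abs_mul]
        gcongr
      have h3 : D + -D / η = (1 - 1 / η) * D := by ring
      rw [h3]
      exact neg_le_of_abs_le this
    have h2 : e.relDensity η h κ (Y ω) * e.wealth η h κ (Y ω)
        = Real.exp (-e.refLog η κ / η) * (Real.exp (D + -D / η) * e.signalWeight (Y ω) h) := by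
      rw [wealth_eq_mul, relDensity, ← hD, Real.exp_add]
      ring
    rw [h2]
    have := (signalWeight_pos (e := e) (Y ω) h).le
    gcongr
  · refine (mul_le_mul_of_nonneg_left (le_abs_self _) (relDensity_pos η h κ _).le).trans ?_
    exact mul_le_mul_of_nonneg_right (relDensity_le_envelope he hη h κ _) (abs_nonneg _)

theorem integral_signalWeight_damped_pos (he : e.ValidParameters) (hPsi : e.ValidPayoff)
    {m : ℝ} (hm : 0 ≤ m) (h : Vec d) (hY : AEStronglyMeasurable Y P) :
    0 < ∫ ω, Real.exp (-(m * (|e.vartheta (Y ω) h| / (e.alphaI + e.alphaN))))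
      * e.signalWeight (Y ω) h ∂P := by
  have hα := he.alpha_pos
  have hc : Continuous fun x => Real.exp (-(m * (|e.vartheta x h| / (e.alphaI + e.alphaN))))
      * e.signalWeight x h :=
    (Real.continuous_exp.comp
      (((continuous_vartheta hPsi h).abs.div_const _).const_mul m).neg).mul
      (continuous_signalWeight h)
  refine (priceDefined_of_le_envelope he hPsi (h := h) hY (C := 1) hc
    (fun x => mul_pos (Real.exp_pos _) (signalWeight_pos x h)) fun x => ?_).2.1
  have h1 : Real.exp (-(m * (|e.vartheta x h| / (e.alphaI + e.alphaN)))) ≤ 1 :=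
    Real.exp_le_one_iff.2 (neg_nonpos.2 (by positivity))
  have h2 := mul_le_mul_of_nonneg_right h1 (signalWeight_pos (e := e) x h).le
  rw [envelope]
  linarith [limitWeight_pos (e := e) x h]

theorem exists_budgetGap_nonpos (he : e.ValidParameters) (hPsi : e.ValidPayoff) (hη : 0 < η)
    (h : Vec d) (hY : AEStronglyMeasurable Y P) : ∃ κ, e.budgetGap P Y η h κ ≤ 0 := by
  have hI := integral_signalWeight_damped_pos he hPsi (abs_nonneg (1 - 1 / η)) h hY
  set I := ∫ ω, Real.exp (-(|1 - 1 / η| * (|e.vartheta (Y ω) h| / (e.alphaI + e.alphaN))))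
      * e.signalWeight (Y ω) h ∂P
  set C := ∫ ω, e.envelope h (Y ω) * |inner ℝ e.shareU (e.payoff (Y ω))| ∂P with hC
  have hC0 : 0 ≤ C := integral_nonneg fun ω => mul_nonneg (envelope_pos _ _).le (abs_nonneg _)
  have hW : 0 < C / I + 1 := by positivity
  -- This `κ` makes the reference wealth equal to `C / I + 1`, above the bound `C / I` that a
  -- nonnegative gap would impose.
  refine ⟨clearingMap e.omegaU (e.alphaI + e.alphaN) η (-η * Real.log (C / I + 1)), ?_⟩
  by_contra! hgap
  have := wealth_bound_of_budgetGap_nonneg he hPsi hη le_rfl h hY hgap.le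
  rw [refLog, logClearing_clearingMap he.omegaU_pos he.alpha_pos hη] at this
  have h1 : -(-η * Real.log (C / I + 1)) / η = Real.log (C / I + 1) := by field_simp
  rw [h1, Real.exp_log hW, ← le_div_iff₀ hI] at this
  linarith

/-- As the reference wealth tends to zero, wealth vanishes and the density tends to the limit
weight, so the gap tends to the expected endowment under that weight, which is positive. -/
theorem exists_budgetGap_pos (he : e.ValidParameters) (hPsi : e.ValidPayoff) (hη : 0 < η)
    (h : Vec d) (hY : AEStronglyMeasurable Y P)
    (hU : ∀ᵐ ω ∂P, 0 < inner ℝ e.shareU (e.payoff (Y ω))) :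
    ∃ κ, 0 < e.budgetGap P Y η h κ := by
  -- Parametrizing `κ` by the reference logarithm `l` makes the reference wealth `exp(-l/η)`.
  set κ : ℝ → ℝ := clearingMap e.omegaU (e.alphaI + e.alphaN) η with hκ
  have href : ∀ l, e.refLog η (κ l) = l := logClearing_clearingMap he.omegaU_pos he.alpha_pos hη
  have hW : Tendsto (fun l => Real.exp (-e.refLog η (κ l) / η)) atTop (𝓝 0) := by
    simp only [href]
    exact Real.tendsto_exp_atBot.comp (tendsto_neg_atTop_atBot.atBot_div_const hη)
  have hlim : ∀ s : ℝ, Tendsto (fun l => Real.exp (-e.refLog η (κ l) / η)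
      * (Real.exp (s / η) - 1)) atTop (𝓝 0) := fun s => by
    simpa using hW.mul_const (Real.exp (s / η) - 1)
  have hwealth : ∀ x, Tendsto (fun l => e.wealth η h (κ l) x) atTop (𝓝 0) := fun x => by
    have h1 := hW.mul_const (Real.exp (|e.vartheta x h| / (e.alphaI + e.alphaN) / η))
    rw [zero_mul] at h1
    refine squeeze_zero (fun l => (wealth_pos η h (κ l) x).le) (fun l => ?_) h1
    rw [wealth_eq_mul]
    refine mul_le_mul_of_nonneg_left (Real.exp_le_exp.2 ?_) (Real.exp_pos _).le
    exact (le_abs_self _).trans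
      (abs_neg_sub_div_le he.omegaU_pos he.alpha_pos hη (e.vartheta x h) (κ l))
  have hmain : Tendsto (fun l => e.budgetGap P Y η h (κ l)) atTop
      (𝓝 (∫ ω, (inner ℝ e.shareU (e.payoff (Y ω)) - 0) * e.limitWeight h (Y ω) ∂P)) := by
    refine tendsto_integral_filter_of_dominated_convergence _ ?_ ?_
      (integrable_budget_bound he hPsi h hY 1) ?_
    · exact Eventually.of_forall fun l =>
        aestronglyMeasurable_budget_integrand he hPsi hη h (κ l) hY
    · filter_upwards [hW.eventually_lt_const one_pos] with l hl
      exact ae_of_all _ fun ω => norm_budget_integrand_le he hη h hl.le _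
    · exact ae_of_all _ fun ω => ((hwealth (Y ω)).const_sub _).mul
        (tendsto_relDensity he (Eventually.of_forall fun _ => hη) hlim h (Y ω))
  have hpos : 0 < ∫ ω, (inner ℝ e.shareU (e.payoff (Y ω)) - 0) * e.limitWeight h (Y ω) ∂P := by
    refine integral_pos_of_pos ?_ ?_
    · filter_upwards [hU] with ω hω
      rw [sub_zero]
      exact mul_pos hω (limitWeight_pos _ _)
    · simp only [sub_zero, mul_comm (inner ℝ e.shareU _)]
      exact integrable_smul_of_le_envelope he hPsi hY (continuous_limitWeight hPsi h)
        (fun x => (abs_of_pos (limitWeight_pos x h)).trans_le (limitWeight_le_envelope h x))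
        (expGrowth_shareU_payoff hPsi) (continuous_shareU_payoff hPsi)
  obtain ⟨l, hl⟩ := (hmain.eventually_const_lt hpos).exists
  exact ⟨κ l, hl⟩

theorem exists_budgetHolds (he : e.ValidParameters) (hPsi : e.ValidPayoff) (hη : 0 < η)
    (h : Vec d) (hY : AEStronglyMeasurable Y P)
    (hU : ∀ᵐ ω ∂P, 0 < inner ℝ e.shareU (e.payoff (Y ω))) :
    ∃ κ, e.BudgetHolds P Y (crra η) h κ := by
  obtain ⟨κ₁, h₁⟩ := exists_budgetGap_nonpos he hPsi hη h hY
  obtain ⟨κ₂, h₂⟩ := exists_budgetGap_pos he hPsi hη h hY hU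
  obtain ⟨κ, hκ⟩ := mem_range_of_exists_le_of_exists_ge (continuous_budgetGap he hPsi hη h hY)
    ⟨κ₁, h₁⟩ ⟨κ₂, h₂.le⟩
  exact ⟨κ, (budgetHolds_iff he hη h κ P Y).2 hκ⟩

/-- Under the budget constraint the effect of the uninformed agent on the relative prices of the
states vanishes as the risk aversion tends to infinity. -/
theorem tendsto_wealth_effect (he : e.ValidParameters) (hPsi : e.ValidPayoff) (h : Vec d)
    (hY : AEStronglyMeasurable Y P) {κ : ℝ → ℝ}
    (hκ : ∀ η, 0 < η → e.BudgetHolds P Y (crra η) h (κ η)) (s : ℝ) :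
    Tendsto (fun η => Real.exp (-e.refLog η (κ η) / η) * (Real.exp (s / η) - 1)) atTop (𝓝 0) := by
  -- With damping constant `m = 1`, which is admissible for all `η ≥ 1`, the integrals `I` and `C`
  -- do not depend on `η`.
  have hI := integral_signalWeight_damped_pos he hPsi zero_le_one h hY
  set I := ∫ ω, Real.exp (-(1 * (|e.vartheta (Y ω) h| / (e.alphaI + e.alphaN))))
      * e.signalWeight (Y ω) h ∂P
  set C := ∫ ω, e.envelope h (Y ω) * |inner ℝ e.shareU (e.payoff (Y ω))| ∂P with hC
  have h1 : Tendsto (fun η : ℝ => C / I * |Real.exp (s / η) - 1|) atTop (𝓝 0) := by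
    have h2 : Tendsto (fun η : ℝ => s / η) atTop (𝓝 0) := tendsto_id.const_div_atTop s
    have h3 := (((Real.continuous_exp.tendsto 0).comp h2).sub_const 1).abs.const_mul (C / I)
    simpa using h3
  refine squeeze_zero_norm' ?_ h1
  filter_upwards [eventually_ge_atTop 1] with η hη1
  have hη : 0 < η := one_pos.trans_le hη1
  have hm : |1 - 1 / η| ≤ 1 := by
    have h3 : 1 / η ≤ 1 := (div_le_one hη).2 hη1
    have h4 : 0 < 1 / η := by positivity
    rw [abs_le]
    constructor <;> linarith
  have hb := wealth_bound_of_budgetGap_nonneg he hPsi hη hm h hY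
    ((budgetHolds_iff he hη h (κ η) P Y).1 (hκ η hη)).ge
  rw [norm_mul, Real.norm_of_nonneg (Real.exp_pos _).le, Real.norm_eq_abs]
  gcongr
  rwa [le_div_iff₀ hI]

end Economy

/-! ### The terminal factor -/

theorem IsStrongSolution.aestronglyMeasurable [MeasurableSpace Ω] {P : Measure Ω}
    {B : ℝ≥0 → Ω → Vec d} (hB : IsBrownianVec P B) {b : Vec d → Vec d}
    {a : Vec d → Matrix (Fin d) (Fin d) ℝ} {T s : ℝ≥0} {x : Vec d} {X : ℝ≥0 → Ω → Vec d}
    (hX : IsStrongSolution P B b a T s x X) {t : ℝ≥0} (hs : s ≤ t) (ht : t ≤ T) :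
    AEStronglyMeasurable (X t) P :=
  (hX.adapted t hs ht).mono (iSup₂_le fun r _ => (hB.measurable r).comap_le)

end MixedEconomy

/-- `X s x` is the factor process started from `x` at time `s`; the factor process of the economy
is `X 0 x₀`, and, since it is a Markov process, a conditional expectation `E[φ(X_T) | X_t = x]` is
the expectation of `φ (X t x T)`. The function `κhat` is any choice of constants that enforce the
budget constraint of the uninformed agent. -/
theorem proposition8p1 {d : ℕ} {Ω : Type*} [MeasurableSpace Ω] (P : Measure Ω)
    [IsProbabilityMeasure P] (B : ℝ≥0 → Ω → MixedEconomy.Vec d)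
    (hB : MixedEconomy.IsBrownianVec P B)
    (b : MixedEconomy.Vec d → MixedEconomy.Vec d)
    (a : MixedEconomy.Vec d → Matrix (Fin d) (Fin d) ℝ)
    (hba : MixedEconomy.IsRegularDiffusion b a)
    (T : ℝ≥0) (hT : 0 < T) (x₀ : MixedEconomy.Vec d)
    (X : ℝ≥0 → MixedEconomy.Vec d → ℝ≥0 → Ω → MixedEconomy.Vec d)
    (hX : ∀ s, s ≤ T → ∀ x, MixedEconomy.IsStrongSolution P B b a T s x (X s x))
    (e : MixedEconomy.Economy d) (he : e.ValidParameters) (hPsi : e.ValidPayoff)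
    (hU : ∀ᵐ ω ∂P, 0 < inner ℝ e.shareU (e.payoff (X 0 x₀ T ω))) :
    -- for every risk aversion, the budget constraint can be enforced
    (∀ η : ℝ, 0 < η → ∀ h, ∃ κ,
      e.BudgetHolds P (X 0 x₀ T) (MixedEconomy.crra η) h κ) ∧
    -- and the resulting pricing measure clears the market
    (∀ η : ℝ, 0 < η → ∀ h κ, e.BudgetHolds P (X 0 x₀ T) (MixedEconomy.crra η) h κ →
      e.Clears P (X 0 x₀ T) (MixedEconomy.crra η) h
        (e.multiplier P (X 0 x₀ T) (MixedEconomy.crra η) h κ)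
        (e.pricingDensity P (X 0 x₀ T) (MixedEconomy.crra η) h κ)) ∧
    -- the equilibrium prices are defined and converge
    (∀ κhat : ℝ → MixedEconomy.Vec d → ℝ,
      (∀ η : ℝ, 0 < η → ∀ h,
        e.BudgetHolds P (X 0 x₀ T) (MixedEconomy.crra η) h (κhat η h)) →
      ∀ t, t ≤ T → ∀ x h,
        (∀ η : ℝ, 0 < η → e.PriceDefined P (X t x T)
          (e.pricingDensity P (X 0 x₀ T) (MixedEconomy.crra η) h (κhat η h))) ∧
        e.PriceDefined P (X t x T) (e.limitWeight h) ∧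
        Tendsto (fun η : ℝ => e.price P (X t x T)
            (e.pricingDensity P (X 0 x₀ T) (MixedEconomy.crra η) h (κhat η h)))
          atTop (𝓝 (e.price P (X t x T) (e.limitWeight h)))) ∧
    -- the limit is the price in the economy with only the two CARA agents
    (∀ h, (∃ Z, e.ClearsCARA P (X 0 x₀ T) h Z) ∧
      ∀ Z, e.ClearsCARA P (X 0 x₀ T) h Z → ∀ t, t ≤ T → ∀ x,
        e.price P (X t x T) Z = e.price P (X t x T) (e.limitWeight h)) := by
  have hY : ∀ s, s ≤ T → ∀ x, AEStronglyMeasurable (X s x T) P := fun s hs x =>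
    (hX s hs x).aestronglyMeasurable hB hs le_rfl
  have hY₀ := hY 0 T.2 x₀
  refine ⟨fun η hη h => MixedEconomy.Economy.exists_budgetHolds he hPsi hη h hY₀ hU, fun η hη h κ hb =>
    MixedEconomy.Economy.clears_of_budgetHolds he hPsi hη h κ hY₀ hb, fun κhat hκ t ht x h => ?_, fun h =>
    ⟨⟨_, MixedEconomy.Economy.clearsCARA_limitWeight he hPsi h hY₀⟩, fun Z hZ t _ x =>
      MixedEconomy.Economy.price_eq_of_clearsCARA he hZ P (X t x T)⟩⟩
  have hc : ∀ η, 0 < η → 0 < (∫ ω, e.relDensity η h (κhat η h) (X 0 x₀ T ω) ∂P)⁻¹ := fun η hη =>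
    inv_pos.2 (MixedEconomy.Economy.priceDefined_relDensity he hPsi hη h _ hY₀).2.1
  refine ⟨fun η hη => ?_, MixedEconomy.Economy.priceDefined_limitWeight he hPsi h (hY t ht x), ?_⟩
  · rw [MixedEconomy.Economy.pricingDensity_crra he hη]
    refine MixedEconomy.Economy.priceDefined_of_le_envelope he hPsi (h := h) (hY t ht x)
      (continuous_const.mul (MixedEconomy.Economy.continuous_relDensity he hPsi hη h _))
      (fun y => mul_pos (hc η hη) (MixedEconomy.Economy.relDensity_pos _ _ _ _)) fun y =>
      mul_le_mul_of_nonneg_left (MixedEconomy.Economy.relDensity_le_envelope he hη h _ y)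
        (hc η hη).le
  -- The budget constraint concerns the law of `X 0 x₀ T`, the price that of `X t x T`. They are
  -- linked only by the scalar reference wealth, whose effect vanishes, so convergence holds for
  -- every `t` and `x`.
  · refine (MixedEconomy.Economy.tendsto_price_relDensity he hPsi (eventually_gt_atTop 0)
      (MixedEconomy.Economy.tendsto_wealth_effect he hPsi h hY₀ fun η hη => hκ η hη h) h
      (hY t ht x)).congr' ?_
    filter_upwards [eventually_gt_atTop 0] with η hη
    rw [MixedEconomy.Economy.pricingDensity_crra he hη,
      MixedEconomy.Economy.price_const_mul e P (X t x T) (hc η hη).ne']
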